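/- Let $n\ge 1$ and let $\mathcal U^+$ be the positive part of the quantized enveloping algebra of type $A_n$: the $\mathbb Q(v)$-algebra with generators $E_1,\dots,E_n$ and relations $E_iE_j=E_jE_i$ for $|i-j|\ge 2$ and $E_i^2E_j-(v+v^{-1})E_iE_jE_i+E_jE_i^2=0$ for $|i-j|=1$. Put $[m]=\frac{v^m-v^{-m}}{v-v^{-1}}$, $[m]!=[1]\cdots[m]$, $x^{(m)}=x^m/[m]!$, and $\left[{a\atop m}\right]=\prod_{i=1}^m\frac{v^{a+1-i}-v^{-a-1+i}}{v^i-v^{-i}}$ for $a\in\mathbb Z$, $m\in\mathbb N$. Let $\overline{\,\cdot\,}$ be the $\mathbb Q$-linear ring involution of $\mathcal U^+$ that fixes all $E_i$ and interchanges $v$ and $v^{-1}$. Define root elements for $1\le i\le j\le n$ by $E_{i,i}=E_i$ and $E_{i,j}=E_iE_{i+1,j}-v^{-1}E_{i+1,j}E_i$ for $i<j$. Isomorphism classes of finite-dimensional representations $M\simeq\bigoplus_{i\le j}U_{i,j}^{\oplus m_{i,j}}$ of the quiver $1\to 2\to\cdots\to n$ (with $U_{i,j}$ the indecomposable representation supported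 on $\{i,\dots,j\}$) correspond to tuples $(m_{i,j})_{1\le i\le j\le n}$ of non-negative integers. The associated PBW element $E_{[M]}$ is the product of all $E_{i,j}^{(m_{i,j})}$ in the order $(n,n),(n-1,n),(n-1,n-1),(n-2,n),(n-2,n-1),(n-2,n-2),\dots,(1,n),\dots,(1,1)$, that is, for the reduced expression $(n,\,n-1,n,\,n-2,n-1,n,\,\dots,\,1,\dots,n)$ of the longest Weyl group element. The canonical basis $\mathcal B$ consists of the elements $\mathcal E_{[M]}$ such that $\overline{\mathcal E_{[M]}}=\mathcal E_{[M]}$ and $\mathcal E_{[M]}=\sum_{[N]}\zeta^M_N E_{[N]}$ (a finite sum) with $\zeta^M_M=1$ and $\zeta^M_N\in v^{-1}\mathbb Z[v^{-1}]$ for all $[N]\ne[M]$; the element $\mathcal E_{[M]}$ is said to be attached to $M$. Let ${\bf r}=(r_1,\dots,r_{n-1})$ and ${\bf h}=(h_1,\dots,h_n)$ be tuples of non-negative integers, and set $r_0=r_n=0$ and $E_0=E_{n+1}=E_{n,n+1}=1$. Let $M({\bf r},{\bf h})=\bigoplus_{i=1}^nU_{i,i}^{\oplus h_i}\oplus\bigoplus_{i=1}^{n-1}U_{i,i+1}^{\oplus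 r_i}$ and $$E({\bf r},{\bf h})=E_n^{(h_n)}E_{n-1,n}^{(r_{n-1})}E_{n-1}^{(h_{n-1})}\cdots E_2^{(h_2)}E_{1,2}^{(r_1)}E_1^{(h_1)}.$$ Define $$B_{i,j}=E_{j-1}^{(r_{j-1})}E_j^{(r_{j-1})}\cdots E_{i+1}^{(r_{i+1})}E_{i+2}^{(r_{i+1})}\,E_i^{(r_i)}E_{i+1}^{(r_i)}$$ (so $B_{i,j}=1$ if $j\le i$), and for $1\le i\le n$ $$C_i=\sum_{u=0}^{r_i}\left[{-h_i\atop u}\right]E_i^{(r_i-u)}E_{i+1}^{(r_i)}E_{i-1}^{(r_{i-1})}E_i^{(h_i+r_{i-1}+u)}.$$ **Theorem.** Suppose that $\Omega=\{i\in\{1,\dots,n\}\mid h_i\ne0\}=\{i_1<\dots<i_s\}$ is sparse, i.e. for each $i=1,\dots,n-1$ one has $i\notin\Omega$ or $i+1\notin\Omega$. Then the element $$\mathcal E_\Omega({\bf r},{\bf h})=B_{i_s+1,n}\,C_{i_s}\,B_{i_{s-1}+1,i_s-1}\,C_{i_{s-1}}\cdots C_{i_2}\,B_{i_1+1,i_2-1}\,C_{i_1}\,B_{1,i_1-1}$$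 (to be read as $B_{1,n}$ if $\Omega=\emptyset$) belongs to $\mathcal B$. More precisely, it is the canonical basis element attached to $M({\bf r},{\bf h})$, whose PBW element is $E_{[M({\bf r},{\bf h})]}=E({\bf r},{\bf h})$. -/

import Mathlib

noncomputable section

namespace QGroup

/-- The base field `ℚ(v)`. -/
abbrev K : Type := RatFunc ℚ

/-- The indeterminate `v`. -/
def v : K := RatFunc.X

theorem v_ne_zero : v ≠ 0 := RatFunc.X_ne_zero

theorem transcendental_v_inv : Transcendental ℚ (v⁻¹ : K) :=
  fun h => by
    have h2 : Transcendental ℚ (RatFunc.X : K) := by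
      convert RatFunc.transcendental_X (K := ℚ)
      exact Subsingleton.elim _ _
    exact h2 (IsAlgebraic.inv_iff.mp h)

/-- The field endomorphism of `ℚ(v)` with `v ↦ v⁻¹`. -/
def barK : K →+* K :=
  RatFunc.liftRingHom (Polynomial.aeval (v⁻¹ : K)).toRingHom
    (nonZeroDivisors_le_comap_nonZeroDivisors_of_injective _
      (transcendental_iff_injective.mp transcendental_v_inv))

theorem barK_v : barK v = v⁻¹ := by
  simp [v, barK]

/-- `[n] = (v^n - v^{-n}) / (v - v^{-1})`. -/
def qInt (n : ℕ) : K := (v ^ n - v⁻¹ ^ n) / (v - v⁻¹)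

/-- `[n]! = [1] [2] ⋯ [n]`. -/
def qFactorial (n : ℕ) : K := ∏ i ∈ Finset.Icc 1 n, qInt i

/-- The quantum binomial coefficient for an arbitrary integer `a` on top. -/
def qBinom (a : ℤ) (n : ℕ) : K :=
  ∏ i ∈ Finset.Icc 1 n, (v ^ (a + 1 - (i : ℤ)) - v ^ (-a - 1 + (i : ℤ))) / (v ^ i - v⁻¹ ^ i)

/-- The subring `ℤ[v⁻¹]` of `ℚ(v)`. -/
def Zv : Subalgebra ℤ K := Algebra.adjoin ℤ {v⁻¹}

section UPlus

variable {I : Type} (A : Matrix I I ℤ)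

/-- The quantum Serre relations for a simply laced Cartan matrix `A`. -/
inductive SerreRel : FreeAlgebra K I → FreeAlgebra K I → Prop
  | comm (i j : I) (h : A i j = 0) :
      SerreRel (FreeAlgebra.ι K i * FreeAlgebra.ι K j) (FreeAlgebra.ι K j * FreeAlgebra.ι K i)
  | serre (i j : I) (h : A i j = -1) :
      SerreRel
        (FreeAlgebra.ι K i ^ 2 * FreeAlgebra.ι K j
          - (v + v⁻¹) • (FreeAlgebra.ι K i * FreeAlgebra.ι K j * FreeAlgebra.ι K i)
          + FreeAlgebra.ι K j * FreeAlgebra.ι K i ^ 2)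
        0

/-- The positive part `U^+` of the quantized enveloping algebra attached to `A`: the
`ℚ(v)`-algebra with generators `E_i` and the quantum Serre relations. -/
def UPlus : Type := RingQuot (SerreRel A)

instance : Ring (UPlus A) := inferInstanceAs (Ring (RingQuot (SerreRel A)))
instance : Algebra K (UPlus A) := inferInstanceAs (Algebra K (RingQuot (SerreRel A)))

/-- The quotient map from the free algebra. -/
def UPlus.mk : FreeAlgebra K I →ₐ[K] UPlus A := RingQuot.mkAlgHom K (SerreRel A)

/-- The Chevalley generator `E_i`. -/
def UPlus.gen (i : I) : UPlus A := UPlus.mk A (FreeAlgebra.ι K i)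

/-- `U^+` with scalars acting through `v ↦ v⁻¹`. -/
@[reducible] def UPlus.twistedAlgebra : Algebra K (UPlus A) :=
  ((algebraMap K (UPlus A)).comp barK).toAlgebra' fun c x => Algebra.commutes (barK c) x

/-- The `v ↦ v⁻¹` semilinear ring homomorphism from the free algebra to `U^+` that sends each
generator to `E_i`. -/
def UPlus.freeBar : FreeAlgebra K I →+* UPlus A :=
  letI := UPlus.twistedAlgebra A
  RingHomClass.toRingHom (FreeAlgebra.lift (A := UPlus A) K (UPlus.gen A))

theorem UPlus.freeBar_ι (i : I) : UPlus.freeBar A (FreeAlgebra.ι K i) = UPlus.gen A i := by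
  let := UPlus.twistedAlgebra A
  exact FreeAlgebra.lift_ι_apply (A := UPlus A) (UPlus.gen A) i

theorem UPlus.freeBar_algebraMap (c : K) :
    UPlus.freeBar A (algebraMap K _ c) = algebraMap K (UPlus A) (barK c) := by
  let := UPlus.twistedAlgebra A
  exact AlgHom.commutes (FreeAlgebra.lift (A := UPlus A) K (UPlus.gen A)) c

theorem UPlus.freeBar_rel ⦃x y : FreeAlgebra K I⦄ (h : SerreRel A x y) :
    UPlus.freeBar A x = UPlus.freeBar A y := by
  have key : UPlus.mk A x = UPlus.mk A y := RingQuot.mkAlgHom_rel K h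
  cases h with
  | comm i j h =>
    simpa [UPlus.freeBar_ι, UPlus.gen] using key
  | serre i j h =>
    simp only [Algebra.smul_def, map_add, map_sub, map_mul, map_pow, map_zero, UPlus.freeBar_ι,
      UPlus.freeBar_algebraMap, AlgHom.commutes, map_inv₀, barK_v, inv_inv] at key ⊢
    rw [add_comm (algebraMap K (UPlus A) v⁻¹)]
    exact key

/-- The bar involution of `U^+`: the ring endomorphism fixing all `E_i`, with `v ↦ v⁻¹`. -/
def UPlus.bar : UPlus A →+* UPlus A :=
  RingQuot.lift ⟨UPlus.freeBar A, UPlus.freeBar_rel A⟩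

theorem UPlus.bar_mk (x : FreeAlgebra K I) :
    UPlus.bar A (UPlus.mk A x) = UPlus.freeBar A x := by
  have h : (UPlus.mk A x : UPlus A) = RingQuot.mkRingHom (SerreRel A) x :=
    congrArg (fun f : FreeAlgebra K I →+* RingQuot (SerreRel A) => f x)
      (RingQuot.mkAlgHom_coe K (SerreRel A))
  rw [h]
  exact RingQuot.lift_mkRingHom_apply _ (UPlus.freeBar_rel A) x

theorem UPlus.bar_gen (i : I) : UPlus.bar A (UPlus.gen A i) = UPlus.gen A i := by
  rw [UPlus.gen, UPlus.bar_mk, UPlus.freeBar_ι, UPlus.gen]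

theorem UPlus.bar_smul (c : K) (x : UPlus A) :
    UPlus.bar A (c • x) = barK c • UPlus.bar A x := by
  have h : UPlus.bar A (algebraMap K _ c) = algebraMap K _ (barK c) := by
    rw [← (UPlus.mk A).commutes c, UPlus.bar_mk, UPlus.freeBar_algebraMap]
  rw [Algebra.smul_def, map_mul, h, ← Algebra.smul_def]

end UPlus

/-- The divided power `x^{(m)} = x^m / [m]!`. -/
def dpow {R : Type} [Ring R] [Algebra K R] (x : R) (m : ℕ) : R := (qFactorial m)⁻¹ • x ^ m

/-- The product `f (b-1) * f (b-2) * ⋯ * f a` over the integers `a ≤ i < b`, in decreasing order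
(equal to `1` if `b ≤ a`). -/
def descProd {R : Type} [Monoid R] (a b : ℕ) (f : ℕ → R) : R :=
  ((List.Ico a b).reverse.map f).prod

/-! ### Type `A_n`, with the quiver `1 → 2 → ⋯ → n` -/

/-- `U^+` of type `A_n`. -/
abbrev U (n : ℕ) : Type := UPlus (CartanMatrix.A n)

/-- The generator `E_i` for `1 ≤ i ≤ n`; for all other `i` it is `1` by convention. -/
def E (n i : ℕ) : U n :=
  if h : 1 ≤ i ∧ i ≤ n then UPlus.gen (CartanMatrix.A n) ⟨i - 1, by omega⟩ else 1

/-- `rootVecAux n l i` is the root element `E_{i,i+l}`. -/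
def rootVecAux (n : ℕ) : ℕ → ℕ → U n
  | 0, i => E n i
  | l + 1, i => E n i * rootVecAux n l (i + 1) - v⁻¹ • (rootVecAux n l (i + 1) * E n i)

/-- The root element `E_{i,j}` for `1 ≤ i ≤ j ≤ n`: `E_{i,i} = E_i`, and
`E_{i,j} = E_i E_{i+1,j} - v⁻¹ E_{i+1,j} E_i` for `i < j`. -/
def rootVec (n i j : ℕ) : U n := rootVecAux n (j - i) i

/-- The positive roots `α_{i,j}`, `1 ≤ i ≤ j ≤ n`, that is, the indecomposable representations
`U_{i,j}` of the quiver. -/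
abbrev PosRoot (n : ℕ) : Type := {p : ℕ × ℕ // 1 ≤ p.1 ∧ p.1 ≤ p.2 ∧ p.2 ≤ n}

/-- Isomorphism classes of finite-dimensional representations of the quiver, given by the
multiplicities `m_{i,j}` of the indecomposables `U_{i,j}`. -/
abbrev RepClass (n : ℕ) : Type := PosRoot n → ℕ

/-- The multiplicity `m_{i,j}`, extended by zero. -/
def RepClass.mult {n : ℕ} (M : RepClass n) (i j : ℕ) : ℕ :=
  if h : 1 ≤ i ∧ i ≤ j ∧ j ≤ n then M ⟨(i, j), h⟩ else 0

/-- The PBW element `E_{[M]}` for the reduced expression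
`(n, n-1, n, n-2, n-1, n, …, 1, …, n)` of the longest element: the product of the divided powers
`E_{i,j}^{(m_{i,j})}`, in the order
`(n,n), (n-1,n), (n-1,n-1), (n-2,n), (n-2,n-1), (n-2,n-2), …, (1,n), …, (1,1)`. -/
def pbw (n : ℕ) (M : RepClass n) : U n :=
  descProd 1 (n + 1) fun i => descProd i (n + 1) fun j => dpow (rootVec n i j) (M.mult i j)

/-- `x` is the canonical basis element attached to `M`: it is fixed by the bar involution, and in
`x = ∑_N ζ_N E_{[N]}` one has `ζ_M = 1` and `ζ_N ∈ v⁻¹ ℤ[v⁻¹]` for all `N ≠ M`. -/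
def IsCanonicalAt (n : ℕ) (M : RepClass n) (x : U n) : Prop :=
  UPlus.bar (CartanMatrix.A n) x = x ∧
  ∃ ζ : RepClass n →₀ K,
    (x = ζ.sum fun N c => c • pbw n N) ∧
    ζ M = 1 ∧
    ∀ N, N ≠ M → ∃ c ∈ Zv, ζ N = v⁻¹ * c

/-- The canonical basis of `U^+` of type `A_n`. -/
def canonicalBasis (n : ℕ) : Set (U n) := {x | ∃ M, IsCanonicalAt n M x}

/-! ### The elements attached to `(r, h)`

The tuples are functions `r h : ℕ → ℕ`, of which only `r_0, …, r_n` (with `r_0 = r_n = 0`) and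
`h_1, …, h_n` are used. -/

/-- The class of `M(r,h) = ⊕ S_i^{h_i} ⊕ ⊕ U_{i,i+1}^{r_i}`. -/
def Mrh (n : ℕ) (r h : ℕ → ℕ) : RepClass n := fun p =>
  if p.1.2 = p.1.1 then h p.1.1 else if p.1.2 = p.1.1 + 1 then r p.1.1 else 0

/-- `E(r,h) = E_n^{(h_n)} E_{n-1,n}^{(r_{n-1})} E_{n-1}^{(h_{n-1})} ⋯ E_{1,2}^{(r_1)} E_1^{(h_1)}`
(the factor with exponent `r_n = 0` is `1`). -/
def Erh (n : ℕ) (r h : ℕ → ℕ) : U n :=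
  descProd 1 (n + 1) fun i => dpow (rootVec n i (i + 1)) (r i) * dpow (E n i) (h i)

/-- `B_{i,j} = E_{j-1}^{(r_{j-1})} E_j^{(r_{j-1})} ⋯ E_i^{(r_i)} E_{i+1}^{(r_i)}`, which is `1`
for `j ≤ i`. -/
def B (n : ℕ) (r : ℕ → ℕ) (i j : ℕ) : U n :=
  descProd i j fun p => dpow (E n p) (r p) * dpow (E n (p + 1)) (r p)

/-- `C_i = ∑_{u=0}^{r_i} [-h_i; u] E_i^{(r_i-u)} E_{i+1}^{(r_i)} E_{i-1}^{(r_{i-1})}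
E_i^{(h_i+r_{i-1}+u)}`. -/
def C (n : ℕ) (r h : ℕ → ℕ) (i : ℕ) : U n :=
  ∑ u ∈ Finset.range (r i + 1), qBinom (-(h i : ℤ)) u •
    (dpow (E n i) (r i - u) * dpow (E n (i + 1)) (r i) * dpow (E n (i - 1)) (r (i - 1))
      * dpow (E n i) (h i + r (i - 1) + u))

/-- `Ω(r,h) = {i = 1, …, n | h_i ≠ 0}`. -/
def Omega (n : ℕ) (h : ℕ → ℕ) : Finset ℕ := (Finset.Icc 1 n).filter fun i => h i ≠ 0

/-- A set of vertices is sparse if it contains no two consecutive vertices. -/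
def IsSparse (n : ℕ) (S : Finset ℕ) : Prop := ∀ i, 1 ≤ i → i + 1 ≤ n → i ∉ S ∨ i + 1 ∉ S

/-- For an increasing list `i_1 < ⋯ < i_s`, the product
`B_{i_s+1,n} C_{i_s} B_{i_{s-1}+1,i_s-1} ⋯ B_{i_1+1,i_2-1} C_{i_1} B_{a,i_1-1}`;
it is `B_{a,n}` for the empty list. -/
def EOmegaAux (n : ℕ) (r h : ℕ → ℕ) : ℕ → List ℕ → U n
  | a, [] => B n r a n
  | a, i :: l => EOmegaAux n r h (i + 1) l * C n r h i * B n r a (i - 1)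

/-- The element `E_Ω(r,h)` for `Ω = Ω(r,h) = {i_1 < ⋯ < i_s}`. -/
def EOmega (n : ℕ) (r h : ℕ → ℕ) : U n := EOmegaAux n r h 1 ((Omega n h).sort)

end QGroup

end

noncomputable section

namespace QGroup

/-! ### Quantum integers and binomial coefficients -/

/-! All factors are products of divided powers of the `E n i`, with bar-invariant quantum binomials
as coefficients, so bar-invariance is immediate. The content is the PBW expansion. Straightening
with the type A₂ formula `dpow_mul_dpow_add` replaces some copies of each U_{p,p+1} by their two
simple constituents, so the PBW terms are indexed by tuples x with x_p ≤ r_p. The coefficient at x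
lies in v^{-q(x)} ℤ[v⁻¹] with q(x) = ∑ (x_p² - x_p x_{p+1}). This form is positive definite on the
relevant tuples (`quadForm_pos`), so every x ≠ 0 contributes to v⁻¹ℤ[v⁻¹], while x = 0 gives E(r,h)
with coefficient 1.

The bound is proved by multiplying the factors from left to right. In a factor of B, commutation
contributes v^{-c²}, and merging E_{a+1}^{(c)} with the power of E_{a+1} already present contributes
a Gaussian binomial of degree c·x_{a+1}, the cross term of q (`pbwTail_mul_dpow`). This requires
h_{a+1} = 0; otherwise the degree is too large. At a vertex of Ω the sum defining C_i repairs this: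
two uses of Vandermonde (`cCoeff_eq`) turn its coefficients into sums of terms of sufficiently low
degree (`cCoeff_mem`). Sparseness ensures that both neighbours of such a vertex have h = 0. Linear
independence of the PBW elements is never needed. -/

theorem v_pow_ne_one {m : ℕ} (hm : m ≠ 0) : v ^ m ≠ 1 := by
  intro h
  have h1 : (algebraMap (Polynomial ℚ) K) (Polynomial.X ^ m) = algebraMap (Polynomial ℚ) K 1 := by
    rw [map_pow, RatFunc.algebraMap_X, map_one]
    exact h
  have h2 := congrArg Polynomial.natDegree (RatFunc.algebraMap_injective ℚ h1)
  simp at h2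
  exact hm h2

theorem v_pow_sub_ne_zero {m : ℕ} (hm : m ≠ 0) : v ^ m - v⁻¹ ^ m ≠ 0 := by
  intro h
  have h1 : v ^ (m + m) = 1 := by
    rw [pow_add]
    nth_rewrite 2 [sub_eq_zero.mp h]
    rw [← mul_pow, mul_inv_cancel₀ v_ne_zero, one_pow]
  exact v_pow_ne_one (by omega) h1

theorem v_sub_ne_zero : v - v⁻¹ ≠ 0 := by
  simpa using v_pow_sub_ne_zero one_ne_zero

theorem qInt_ne_zero {m : ℕ} (hm : m ≠ 0) : qInt m ≠ 0 :=
  div_ne_zero (v_pow_sub_ne_zero hm) v_sub_ne_zero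

theorem qFactorial_zero : qFactorial 0 = 1 := by simp [qFactorial]

theorem qFactorial_succ (m : ℕ) : qFactorial (m + 1) = qFactorial m * qInt (m + 1) :=
  Finset.prod_Icc_succ_top (by omega) _

theorem qFactorial_ne_zero (m : ℕ) : qFactorial m ≠ 0 :=
  Finset.prod_ne_zero_iff.mpr fun i hi => qInt_ne_zero (by rw [Finset.mem_Icc] at hi; omega)

theorem qInt_add (a c : ℕ) : qInt (a + c) = v ^ a * qInt c + v⁻¹ ^ c * qInt a := by
  unfold qInt
  rw [pow_add, pow_add]
  ring

theorem qBinom_zero (a : ℤ) : qBinom a 0 = 1 := by simp [qBinom]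

theorem qBinom_succ (a : ℤ) (t : ℕ) :
    qBinom a (t + 1) = qBinom a t * ((v ^ (a - t) - v ^ (t - a)) / (v ^ (t + 1) - v⁻¹ ^ (t + 1))) := by
  unfold qBinom
  rw [Finset.prod_Icc_succ_top (by omega)]
  congr 4 <;> push_cast <;> ring_nf

theorem qBinom_succ_succ (a : ℤ) (t : ℕ) :
    qBinom (a + 1) (t + 1)
      = qBinom a t * ((v ^ (a + 1) - v ^ (-a - 1)) / (v ^ (t + 1) - v⁻¹ ^ (t + 1))) := by
  induction t with
  | zero =>
    rw [qBinom_succ, qBinom_zero, qBinom_zero]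
    congr 4 <;> push_cast <;> ring
  | succ t ih =>
    rw [qBinom_succ (a + 1), ih, qBinom_succ a]
    have e1 : a + 1 - ((t + 1 : ℕ) : ℤ) = a - t := by push_cast; ring
    have e2 : ((t + 1 : ℕ) : ℤ) - (a + 1) = t - a := by push_cast; ring
    rw [e1, e2]
    ring

theorem qBinom_pascal (a : ℤ) (t : ℕ) :
    qBinom (a + 1) (t + 1) = v ^ (t + 1) * qBinom a (t + 1) + v ^ ((t : ℤ) - a) * qBinom a t := by
  have hv := v_ne_zero
  rw [qBinom_succ_succ, qBinom_succ]
  have h := v_pow_sub_ne_zero (Nat.succ_ne_zero t)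
  rw [Nat.succ_eq_add_one] at h
  have e : v ^ (a + 1) - v ^ (-a - 1)
      = v ^ (t + 1) * (v ^ (a - t) - v ^ (t - a)) + v ^ ((t : ℤ) - a) * (v ^ (t + 1) - v⁻¹ ^ (t + 1)) := by
    have e1 : v ^ (a + 1) = v ^ (t + 1) * v ^ (a - t) := by
      rw [← zpow_natCast, ← zpow_add₀ hv]; congr 1; push_cast; ring
    have e2 : v ^ (-a - 1) = v ^ ((t : ℤ) - a) * v⁻¹ ^ (t + 1) := by
      rw [inv_pow, ← zpow_natCast, ← zpow_neg, ← zpow_add₀ hv]; congr 1; push_cast; ring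
    rw [e1, e2]
    ring
  rw [e]
  generalize v ^ (t + 1) - v⁻¹ ^ (t + 1) = D at h ⊢
  field_simp

/-- The bar image of `qBinom_pascal`. Vandermonde uses one form for each of its two arguments. -/
theorem qBinom_pascal' (a : ℤ) (t : ℕ) :
    qBinom (a + 1) (t + 1)
      = v ^ (-(t : ℤ) - 1) * qBinom a (t + 1) + v ^ (a - (t : ℤ)) * qBinom a t := by
  have hv := v_ne_zero
  rw [qBinom_succ_succ, qBinom_succ]
  have h := v_pow_sub_ne_zero (Nat.succ_ne_zero t)
  rw [Nat.succ_eq_add_one] at h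
  have e : v ^ (a + 1) - v ^ (-a - 1)
      = v ^ (-(t : ℤ) - 1) * (v ^ (a - t) - v ^ (t - a))
        + v ^ (a - (t : ℤ)) * (v ^ (t + 1) - v⁻¹ ^ (t + 1)) := by
    have e1 : v ^ (a + 1) = v ^ (t + 1) * v ^ (a - t) := by
      rw [← zpow_natCast, ← zpow_add₀ hv]; congr 1; push_cast; ring
    have e2 : v ^ (-a - 1) = v ^ (-(t : ℤ) - 1) * v ^ ((t : ℤ) - a) := by
      rw [← zpow_add₀ hv]; congr 1; ring
    have e3 : v⁻¹ ^ (t + 1) = v ^ (-(t : ℤ) - 1) := by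
      rw [inv_pow, ← zpow_natCast, ← zpow_neg]; congr 1; push_cast; ring
    rw [e1, e2, e3]
    ring
  rw [e]
  generalize v ^ (t + 1) - v⁻¹ ^ (t + 1) = D at h ⊢
  field_simp

theorem qBinom_zero_succ (t : ℕ) : qBinom 0 (t + 1) = 0 := by
  induction t with
  | zero => simp [qBinom_succ]
  | succ t ih => rw [qBinom_succ, ih, zero_mul]

/-- The quantum Vandermonde identity. -/
theorem qBinom_vandermonde (a : ℕ) (b : ℤ) (t : ℕ) :
    qBinom (a + b) t = ∑ u ∈ Finset.range (t + 1),
      v ^ ((a : ℤ) * u - b * ((t : ℤ) - u)) * qBinom a (t - u) * qBinom b u := by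
  have hv := v_ne_zero
  induction a generalizing b with
  | zero =>
    rw [Finset.sum_eq_single t]
    · simp [qBinom_zero]
    · intro u hu hne
      obtain ⟨k, hk⟩ : ∃ k, t - u = k + 1 := ⟨t - u - 1, by rw [Finset.mem_range] at hu; omega⟩
      rw [hk, Nat.cast_zero, qBinom_zero_succ, mul_zero, zero_mul]
    · simp
  | succ a ih =>
    have e : ((a + 1 : ℕ) : ℤ) + b = a + (b + 1) := by push_cast; ring
    rw [e, ih]
    cases t with
    | zero => simp [qBinom_zero]
    | succ t =>
      have hL : ∀ u ∈ Finset.range (t + 1),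
          v ^ ((a : ℤ) * ((u + 1 : ℕ) : ℤ) - (b + 1) * (((t + 1 : ℕ) : ℤ) - ((u + 1 : ℕ) : ℤ)))
            * qBinom a (t + 1 - (u + 1)) * qBinom (b + 1) (u + 1)
          = v ^ (((a + 1 : ℕ) : ℤ) * ((u + 1 : ℕ) : ℤ) - b * (((t + 1 : ℕ) : ℤ) - ((u + 1 : ℕ) : ℤ))
                - ((t : ℤ) - u)) * qBinom a (t - u) * qBinom b (u + 1)
            + v ^ ((a : ℤ) * (u + 1) - (b + 1) * (t - u) + (u - b)) * qBinom a (t - u) * qBinom b u := by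
        intro u _
        rw [qBinom_pascal, Nat.add_sub_add_right]
        have e1 : v ^ (((a + 1 : ℕ) : ℤ) * ((u + 1 : ℕ) : ℤ)
              - b * (((t + 1 : ℕ) : ℤ) - ((u + 1 : ℕ) : ℤ)) - ((t : ℤ) - u))
            = v ^ ((a : ℤ) * ((u + 1 : ℕ) : ℤ)
                - (b + 1) * (((t + 1 : ℕ) : ℤ) - ((u + 1 : ℕ) : ℤ))) * v ^ (u + 1) := by
          rw [← zpow_natCast v (u + 1), ← zpow_add₀ hv]; congr 1; push_cast; ring
        have e2 : v ^ ((a : ℤ) * (u + 1) - (b + 1) * (t - u) + (u - b))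
            = v ^ ((a : ℤ) * ((u + 1 : ℕ) : ℤ)
                - (b + 1) * (((t + 1 : ℕ) : ℤ) - ((u + 1 : ℕ) : ℤ))) * v ^ ((u : ℤ) - b) := by
          rw [← zpow_add₀ hv]; congr 1; push_cast; ring
        rw [e1, e2]
        ring
      have hR : ∀ u ∈ Finset.range (t + 1),
          v ^ (((a + 1 : ℕ) : ℤ) * (u : ℤ) - b * (((t + 1 : ℕ) : ℤ) - (u : ℤ)))
            * qBinom ((a + 1 : ℕ) : ℤ) (t + 1 - u) * qBinom b u
          = v ^ (((a + 1 : ℕ) : ℤ) * (u : ℤ) - b * (((t + 1 : ℕ) : ℤ) - (u : ℤ))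
                - ((t : ℤ) + 1 - u)) * qBinom a (t + 1 - u) * qBinom b u
            + v ^ ((a : ℤ) * (u + 1) - (b + 1) * (t - u) + (u - b)) * qBinom a (t - u) * qBinom b u := by
        intro u hu
        have hu' : u ≤ t := by rw [Finset.mem_range] at hu; omega
        rw [show t + 1 - u = (t - u) + 1 by omega, Nat.cast_succ, qBinom_pascal', Nat.cast_sub hu']
        have e1 : v ^ (((a : ℤ) + 1) * (u : ℤ) - b * (((t + 1 : ℕ) : ℤ) - (u : ℤ))
                - ((t : ℤ) + 1 - u))
            = v ^ (((a : ℤ) + 1) * (u : ℤ) - b * (((t + 1 : ℕ) : ℤ) - (u : ℤ)))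
              * v ^ (-((t : ℤ) - u) - 1) := by
          rw [← zpow_add₀ hv]; congr 1; push_cast; ring
        have e2 : v ^ ((a : ℤ) * (u + 1) - (b + 1) * (t - u) + (u - b))
            = v ^ (((a : ℤ) + 1) * (u : ℤ) - b * (((t + 1 : ℕ) : ℤ) - (u : ℤ)))
              * v ^ ((a : ℤ) - ((t : ℤ) - u)) := by
          rw [← zpow_add₀ hv]; congr 1; push_cast; ring
        rw [e1, e2]
        ring
      -- Both expansions contain the same second sum. Once it is cancelled, the remaining sums agree
      -- after the shift u ↦ u + 1.
      rw [Finset.sum_range_succ', Finset.sum_congr rfl hL, Finset.sum_add_distrib,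
        Finset.sum_range_succ _ (t + 1), Finset.sum_congr rfl hR, Finset.sum_add_distrib]
      refine (add_right_comm _ _ _).trans (Eq.trans ?_ (add_right_comm _ _ _))
      congr 1
      have hS := Finset.sum_range_succ' (fun u : ℕ =>
        v ^ (((a + 1 : ℕ) : ℤ) * (u : ℤ) - b * (((t + 1 : ℕ) : ℤ) - (u : ℤ)) - ((t : ℤ) + 1 - u))
          * qBinom a (t + 1 - u) * qBinom b u) (t + 1)
      rw [Finset.sum_range_succ] at hS
      convert hS.symm using 2
      · refine Finset.sum_congr rfl fun u _ => ?_
        rw [Nat.add_sub_add_right]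
        congr 3
        push_cast; ring
      · rw [qBinom_zero, qBinom_zero]
        congr 3
        push_cast; ring
      · simp [qBinom_zero]

/-! ### Integrality and degree of Gaussian binomials -/

theorem v_inv_mem_Zv : v⁻¹ ∈ Zv := Algebra.subset_adjoin rfl

theorem v_zpow_neg_mem_Zv {m : ℤ} (hm : 0 ≤ m) : v ^ (-m) ∈ Zv := by
  lift m to ℕ using hm
  rw [zpow_neg, zpow_natCast, ← inv_pow]
  exact pow_mem v_inv_mem_Zv m

/-- The degree in v is at most t(m - t), by Pascal's rule. Vanishing is proved simultaneously
because the top case of the rule involves [m; m+1]. -/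
theorem qBinom_natCast_aux (m : ℕ) : ∀ t : ℕ, (m < t → qBinom m t = 0) ∧
    (t ≤ m → v ^ (-((t : ℤ) * ((m : ℤ) - t))) * qBinom m t ∈ Zv) := by
  have hv := v_ne_zero
  induction m with
  | zero =>
    intro t
    cases t with
    | zero => simp [qBinom_zero]
    | succ t => simp [qBinom_zero_succ]
  | succ m ih =>
    intro t
    cases t with
    | zero => simp [qBinom_zero]
    | succ t =>
      have hp := qBinom_pascal m t
      rw [show ((m : ℤ) + 1) = ((m + 1 : ℕ) : ℤ) by push_cast; ring] at hp
      refine ⟨fun h => ?_, fun h => ?_⟩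
      · rw [hp, (ih t).1 (by omega), (ih (t + 1)).1 (by omega)]
        simp
      · rw [hp, mul_add]
        refine add_mem ?_ ?_
        · rcases Nat.lt_or_ge m (t + 1) with h' | h'
          · rw [(ih (t + 1)).1 h', mul_zero, mul_zero]
            exact zero_mem _
          · rw [← mul_assoc, ← zpow_natCast v, ← zpow_add₀ hv]
            convert (ih (t + 1)).2 h' using 3
            push_cast; ring
        · have e : v ^ (-(((t + 1 : ℕ) : ℤ) * (((m + 1 : ℕ) : ℤ) - ((t + 1 : ℕ) : ℤ))))
                * (v ^ ((t : ℤ) - m) * qBinom m t)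
              = v ^ (-(2 * ((m : ℤ) - t))) * (v ^ (-((t : ℤ) * ((m : ℤ) - t))) * qBinom m t) := by
            rw [← mul_assoc, ← mul_assoc, ← zpow_add₀ hv, ← zpow_add₀ hv]
            congr 2
            push_cast; ring
          rw [e]
          exact mul_mem (v_zpow_neg_mem_Zv (by omega)) ((ih t).2 (by omega))

theorem qBinom_natCast_eq_zero {m t : ℕ} (h : m < t) : qBinom m t = 0 :=
  (qBinom_natCast_aux m t).1 h

theorem qBinom_natCast_mem_Zv {m t : ℕ} (h : t ≤ m) :
    v ^ (-((t : ℤ) * ((m : ℤ) - t))) * qBinom m t ∈ Zv :=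
  (qBinom_natCast_aux m t).2 h

theorem qBinom_mul_qFactorial (a b : ℕ) :
    qBinom ((a + b : ℕ) : ℤ) a * (qFactorial a * qFactorial b) = qFactorial (a + b) := by
  induction a with
  | zero => simp [qBinom_zero, qFactorial_zero]
  | succ a ih =>
    have h := v_pow_sub_ne_zero (Nat.succ_ne_zero a)
    rw [Nat.succ_eq_add_one] at h
    have h1 := v_sub_ne_zero
    rw [Nat.add_right_comm, qFactorial_succ (a + b), ← ih, Nat.cast_succ, qBinom_succ_succ,
      qFactorial_succ]
    have e1 : v ^ (((a + b : ℕ) : ℤ) + 1) = v ^ (a + b + 1) := by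
      rw [← zpow_natCast]; congr 1
    have e2 : v ^ (-((a + b : ℕ) : ℤ) - 1) = v⁻¹ ^ (a + b + 1) := by
      rw [inv_pow, ← zpow_natCast, ← zpow_neg]; congr 1; push_cast; ring
    rw [e1, e2, qInt, qInt]
    generalize v ^ (a + 1) - v⁻¹ ^ (a + 1) = D at h ⊢
    generalize v - v⁻¹ = D' at h1 ⊢
    field_simp

theorem qBinom_symm (a b : ℕ) : qBinom ((a + b : ℕ) : ℤ) b = qBinom ((a + b : ℕ) : ℤ) a := by
  have h := mul_ne_zero (qFactorial_ne_zero a) (qFactorial_ne_zero b)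
  apply mul_right_cancel₀ h
  rw [qBinom_mul_qFactorial, mul_comm (qFactorial a), Nat.add_comm, qBinom_mul_qFactorial]

/-! ### The bar involution on scalars -/

theorem barK_v_zpow (m : ℤ) : barK (v ^ m) = v ^ (-m) := by
  rw [map_zpow₀, barK_v, inv_zpow, zpow_neg]

theorem barK_qInt (m : ℕ) : barK (qInt m) = qInt m := by
  simp only [qInt, map_div₀, map_sub, map_pow, map_inv₀, barK_v, inv_inv]
  rw [← neg_sub (v ^ m), ← neg_sub v, neg_div_neg_eq]

theorem barK_qFactorial (m : ℕ) : barK (qFactorial m) = qFactorial m := by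
  simp only [qFactorial, map_prod, barK_qInt]

theorem barK_qBinom (a : ℤ) (m : ℕ) : barK (qBinom a m) = qBinom a m := by
  rw [qBinom, map_prod]
  refine Finset.prod_congr rfl fun i _ => ?_
  simp only [map_div₀, map_sub, map_pow, map_inv₀, barK_v_zpow, barK_v, inv_inv]
  rw [show -(a + 1 - (i : ℤ)) = -a - 1 + i by ring, show -(-a - 1 + (i : ℤ)) = a + 1 - i by ring,
    ← neg_sub (v ^ i), ← neg_sub (v ^ (a + 1 - (i : ℤ))), neg_div_neg_eq]

/-! ### Divided powers -/

section DividedPowers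

variable {R : Type} [Ring R] [Algebra K R]

theorem dpow_zero (x : R) : dpow x 0 = 1 := by simp [dpow, qFactorial_zero]

theorem dpow_succ_left (x : R) (m : ℕ) : x * dpow x m = qInt (m + 1) • dpow x (m + 1) := by
  have h := qInt_ne_zero (Nat.succ_ne_zero m)
  rw [Nat.succ_eq_add_one] at h
  rw [dpow, dpow, mul_smul_comm, ← pow_succ', smul_smul, qFactorial_succ, mul_inv,
    mul_comm, mul_assoc, inv_mul_cancel₀ h, mul_one]

theorem dpow_succ_right (x : R) (m : ℕ) : dpow x m * x = qInt (m + 1) • dpow x (m + 1) := by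
  rw [← dpow_succ_left, dpow, smul_mul_assoc, mul_smul_comm, pow_mul_comm']

theorem dpow_mul_dpow (x : R) (a b : ℕ) :
    dpow x a * dpow x b = qBinom ((a + b : ℕ) : ℤ) a • dpow x (a + b) := by
  have ha := qFactorial_ne_zero a
  have hb := qFactorial_ne_zero b
  have hab := qFactorial_ne_zero (a + b)
  rw [dpow, dpow, dpow, smul_mul_smul_comm, ← pow_add, smul_smul]
  congr 1
  rw [eq_mul_inv_iff_mul_eq₀ hab, ← qBinom_mul_qFactorial]
  field_simp

theorem mul_dpow_of_qCommute {x z : R} (h : x * z = v • (z * x)) (m : ℕ) :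
    x * dpow z m = v ^ m • (dpow z m * x) := by
  have h1 : x * z ^ m = v ^ m • (z ^ m * x) := by
    induction m with
    | zero => simp
    | succ m ih =>
      rw [pow_succ, ← mul_assoc, ih, smul_mul_assoc, mul_assoc, h, mul_smul_comm, smul_smul,
        ← mul_assoc, pow_succ]
  rw [dpow, mul_smul_comm, h1, smul_mul_assoc, smul_comm]

theorem mul_dpow_succ {x y z : R} (hxy : x * y = z + v⁻¹ • (y * x)) (hzy : z * y = v • (y * z))
    (m : ℕ) :
    x * dpow y (m + 1) = v⁻¹ ^ (m + 1) • (dpow y (m + 1) * x) + dpow y m * z := by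
  have hv := v_ne_zero
  induction m with
  | zero => simp [dpow, qFactorial, qInt, div_self v_sub_ne_zero, hxy, add_comm]
  | succ m ih =>
    have h := qInt_ne_zero (Nat.succ_ne_zero (m + 1))
    rw [Nat.succ_eq_add_one] at h
    have key : qInt (m + 1 + 1) • (x * dpow y (m + 1 + 1))
        = qInt (m + 1 + 1) • (v⁻¹ ^ (m + 1 + 1) • (dpow y (m + 1 + 1) * x) + dpow y (m + 1) * z) := by
      rw [← mul_smul_comm, ← dpow_succ_right, ← mul_assoc, ih, add_mul, smul_mul_assoc, mul_assoc,
        hxy, mul_add, mul_smul_comm, ← mul_assoc, dpow_succ_right, mul_assoc, hzy, mul_smul_comm,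
        ← mul_assoc, dpow_succ_right, smul_mul_assoc, smul_mul_assoc,
        show qInt (m + 1 + 1) = v * qInt (m + 1) + v⁻¹ ^ (m + 1) by
          have := qInt_add 1 (m + 1)
          simpa [qInt, div_self v_sub_ne_zero, add_comm] using this]
      simp only [smul_add, smul_smul]
      rw [add_right_comm, ← add_smul, add_comm]
      congr 2 <;> ring
    exact smul_right_injective R h key

/-- The commutation formula of divided powers in type `A₂`. -/
theorem dpow_mul_dpow_add {x y z : R} (hxy : x * y = z + v⁻¹ • (y * x))
    (hxz : x * z = v • (z * x)) (hzy : z * y = v • (y * z)) (a d : ℕ) :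
    dpow x a * dpow y (a + d) = ∑ c ∈ Finset.range (a + 1),
      v⁻¹ ^ (c * (c + d)) • (dpow y (c + d) * dpow z (a - c) * dpow x c) := by
  have hv := v_ne_zero
  -- Splitting off one x leaves the y-exponent a + (d + 1), so d has to vary.
  induction a generalizing d with
  | zero => simp [dpow_zero]
  | succ a ih =>
    have h := qInt_ne_zero (Nat.succ_ne_zero a)
    rw [Nat.succ_eq_add_one] at h
    refine smul_right_injective R h ?_
    simp only
    rw [← smul_mul_assoc, ← dpow_succ_left, mul_assoc, show a + 1 + d = a + (d + 1) by ring, ih,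
      Finset.mul_sum, Finset.smul_sum]
    have hL : ∀ c ∈ Finset.range (a + 1),
        x * (v⁻¹ ^ (c * (c + (d + 1))) • (dpow y (c + (d + 1)) * dpow z (a - c) * dpow x c))
        = (v⁻¹ ^ ((c + 1) * (c + 1 + d)) * (v ^ (a - c) * qInt (c + 1)))
            • (dpow y (c + 1 + d) * dpow z (a - c) * dpow x (c + 1))
          + (v⁻¹ ^ (c * (c + d)) * (v⁻¹ ^ c * qInt (a + 1 - c)))
            • (dpow y (c + d) * dpow z (a + 1 - c) * dpow x c) := by
      intro c hc
      have hc' : a + 1 - c = a - c + 1 := by rw [Finset.mem_range] at hc; omega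
      rw [mul_smul_comm, ← mul_assoc, ← mul_assoc, show c + (d + 1) = c + d + 1 by ring,
        mul_dpow_succ hxy hzy, add_mul, add_mul, mul_assoc (dpow y (c + d)), dpow_succ_left,
        smul_mul_assoc, smul_mul_assoc, mul_assoc _ x, mul_dpow_of_qCommute hxz, mul_smul_comm,
        smul_mul_assoc, ← mul_assoc, mul_assoc _ x, dpow_succ_left, hc', smul_add,
        mul_smul_comm, mul_smul_comm, smul_mul_assoc, show c + 1 + d = c + d + 1 by ring]
      congr 1
      · rw [smul_smul, smul_smul, smul_smul]
        congr 1
        ring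
      · rw [smul_smul]
        congr 1
        ring
    rw [Finset.sum_congr rfl hL, Finset.sum_add_distrib]
    -- The splitting [a+1] = v^{a+1-c}[c] + v^{-c}[a+1-c] matches the two families in `hL`, the
    -- first after c ↦ c + 1.
    have hR : ∀ c ∈ Finset.range (a + 1 + 1),
        qInt (a + 1) • (v⁻¹ ^ (c * (c + d)) • (dpow y (c + d) * dpow z (a + 1 - c) * dpow x c))
        = (v⁻¹ ^ (c * (c + d)) * (v ^ (a + 1 - c) * qInt c))
            • (dpow y (c + d) * dpow z (a + 1 - c) * dpow x c)
          + (v⁻¹ ^ (c * (c + d)) * (v⁻¹ ^ c * qInt (a + 1 - c)))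
            • (dpow y (c + d) * dpow z (a + 1 - c) * dpow x c) := by
      intro c hc
      have hc' : a + 1 = a + 1 - c + c := by rw [Finset.mem_range] at hc; omega
      rw [← add_smul, smul_smul]
      congr 1
      nth_rewrite 1 [hc']
      rw [qInt_add]
      ring
    rw [Finset.sum_congr rfl hR, Finset.sum_add_distrib, Finset.sum_range_succ' _ (a + 1),
      Finset.sum_range_succ _ (a + 1)]
    simp [qInt]

end DividedPowers

/-! ### Commutation of divided powers of adjacent generators in type `A_n` -/

theorem E_of_le {n i : ℕ} (h1 : 1 ≤ i) (h2 : i ≤ n) :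
    E n i = UPlus.gen (CartanMatrix.A n) ⟨i - 1, by omega⟩ := dif_pos ⟨h1, h2⟩

theorem rootVec_self (n i : ℕ) : rootVec n i i = E n i := by
  simp [rootVec, rootVecAux]

theorem rootVec_succ (n i : ℕ) :
    rootVec n i (i + 1) = E n i * E n (i + 1) - v⁻¹ • (E n (i + 1) * E n i) := by
  simp [rootVec, rootVecAux]

theorem UPlus.gen_serre {I : Type} {A : Matrix I I ℤ} {i j : I} (h : A i j = -1) :
    gen A i ^ 2 * gen A j - (v + v⁻¹) • (gen A i * gen A j * gen A i) + gen A j * gen A i ^ 2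
      = 0 := by
  have key := RingQuot.mkAlgHom_rel K (SerreRel.serre (A := A) i j h)
  change UPlus.mk A _ = UPlus.mk A _ at key
  simp only [map_add, map_sub, map_mul, map_pow, map_smul, map_zero] at key
  exact key

/-- With z = xy - v⁻¹yx, the difference xz - v zx is literally the Serre polynomial. -/
theorem qCommute_of_serre {R : Type} [Ring R] [Algebra K R] {x y : R}
    (h : x ^ 2 * y - (v + v⁻¹) • (x * y * x) + y * x ^ 2 = 0) :
    x * (x * y - v⁻¹ • (y * x)) = v • ((x * y - v⁻¹ • (y * x)) * x) := by
  rw [← sub_eq_zero, ← h, mul_sub, sub_mul, smul_sub, mul_smul_comm, smul_mul_assoc, smul_smul,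
    mul_inv_cancel₀ v_ne_zero, one_smul, add_smul, pow_two]
  simp only [mul_assoc]
  abel

theorem qCommute_of_serre' {R : Type} [Ring R] [Algebra K R] {x y : R}
    (h : y ^ 2 * x - (v + v⁻¹) • (y * x * y) + x * y ^ 2 = 0) :
    (x * y - v⁻¹ • (y * x)) * y = v • (y * (x * y - v⁻¹ • (y * x))) := by
  rw [← sub_eq_zero, ← h, mul_sub, sub_mul, smul_sub, mul_smul_comm, smul_mul_assoc, smul_smul,
    mul_inv_cancel₀ v_ne_zero, one_smul, add_smul, pow_two]
  simp only [mul_assoc]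
  abel

/-- The range condition is imposed only for a ≠ 0: the case a = 0 is trivial, which accommodates the
conventions E_0 = E_{n+1} = 1. -/
theorem dpow_E_mul_dpow_E_succ (n i a d : ℕ) (hi : a ≠ 0 → 1 ≤ i ∧ i + 1 ≤ n) :
    dpow (E n i) a * dpow (E n (i + 1)) (a + d) = ∑ c ∈ Finset.range (a + 1),
      v⁻¹ ^ (c * (c + d)) •
        (dpow (E n (i + 1)) (c + d) * dpow (rootVec n i (i + 1)) (a - c) * dpow (E n i) c) := by
  rcases Nat.eq_zero_or_pos a with rfl | ha
  · simp [dpow_zero]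
  obtain ⟨h1, h2⟩ := hi (by omega)
  refine dpow_mul_dpow_add ?_ ?_ ?_ a d
  · rw [rootVec_succ, sub_add_cancel]
  · rw [rootVec_succ]
    apply qCommute_of_serre
    rw [E_of_le h1 (by omega), E_of_le (by omega) h2]
    apply UPlus.gen_serre
    rw [CartanMatrix.A, Matrix.of_apply, if_neg (by simp; omega), if_pos (by simp; omega)]
  · rw [rootVec_succ]
    apply qCommute_of_serre'
    rw [E_of_le h1 (by omega), E_of_le (by omega) h2]
    apply UPlus.gen_serre
    rw [CartanMatrix.A, Matrix.of_apply, if_neg (by simp; omega), if_pos (by simp; omega)]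

/-! ### The expansion of `C_i` -/

/-- The coefficient of
`E_{i+1}^{(x)} E_{i,i+1}^{(r_i-x)} E_i^{(m+x+y)} E_{i-1,i}^{(r_{i-1}-y)} E_{i-1}^{(y)}` in `C_i`,
where `m = h_i`. -/
def cCoeff (m x y : ℕ) : K :=
  ∑ u ∈ Finset.range (x + 1), qBinom (-(m : ℤ)) u *
    (v⁻¹ ^ ((x - u) * x) * v⁻¹ ^ (y * (y + (m + u))) * qBinom ((m + x + y : ℕ) : ℤ) (x - u))

theorem cCoeff_zero_zero (m : ℕ) : cCoeff m 0 0 = 1 := by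
  simp [cCoeff, qBinom_zero]

/-- Vandermonde for (m+x) + y introduces t. After interchanging the sums, Vandermonde for (m+x) +
(-m) evaluates the sum over u to [x; x-t] = [x; t], so the negative upper index disappears. -/
theorem cCoeff_eq (m x y : ℕ) :
    cCoeff m x y = ∑ t ∈ Finset.range (x + 1),
      v ^ (-((x : ℤ) * x + y * y + y * m + m * x + x * y) + t * (x + y + 2 * m))
        * qBinom x t * qBinom y t := by
  have hv := v_ne_zero
  have h1 : ∀ u ∈ Finset.range (x + 1), qBinom (-(m : ℤ)) u *
      (v⁻¹ ^ ((x - u) * x) * v⁻¹ ^ (y * (y + (m + u))) * qBinom ((m + x + y : ℕ) : ℤ) (x - u))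
      = ∑ t ∈ Finset.range (x - u + 1),
        v ^ (-((x : ℤ) * x + y * y + y * m + m * x + x * y) + t * (x + y + 2 * m))
          * (v ^ (((m + x : ℕ) : ℤ) * u - (-(m : ℤ)) * (((x - t : ℕ) : ℤ) - u))
              * qBinom ((m + x : ℕ) : ℤ) (x - t - u) * qBinom (-(m : ℤ)) u)
          * qBinom y t := by
    intro u hu
    rw [show ((m + x + y : ℕ) : ℤ) = ((m + x : ℕ) : ℤ) + (y : ℕ) by push_cast; ring,
      qBinom_vandermonde, Finset.mul_sum, Finset.mul_sum]
    refine Finset.sum_congr rfl fun t ht => ?_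
    rw [Finset.mem_range] at hu ht
    have e : v⁻¹ ^ ((x - u) * x) * v⁻¹ ^ (y * (y + (m + u)))
          * v ^ (((m + x : ℕ) : ℤ) * t - (y : ℤ) * (((x - u : ℕ) : ℤ) - t))
        = v ^ (-((x : ℤ) * x + y * y + y * m + m * x + x * y) + t * (x + y + 2 * m))
          * v ^ (((m + x : ℕ) : ℤ) * u - (-(m : ℤ)) * (((x - t : ℕ) : ℤ) - u)) := by
      rw [inv_pow, inv_pow, ← zpow_natCast, ← zpow_natCast, ← zpow_neg, ← zpow_neg,
        ← zpow_add₀ hv, ← zpow_add₀ hv, ← zpow_add₀ hv]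
      congr 1
      push_cast [Nat.cast_sub (show u ≤ x by omega), Nat.cast_sub (show t ≤ x by omega)]
      ring
    rw [show x - u - t = x - t - u by omega]
    linear_combination (qBinom ((m + x : ℕ) : ℤ) (x - t - u) * qBinom y t * qBinom (-(m : ℤ)) u) * e
  rw [cCoeff, Finset.sum_congr rfl h1,
    Finset.sum_comm' (t' := Finset.range (x + 1)) (s' := fun t => Finset.range (x - t + 1))
      (by intro u t; simp only [Finset.mem_range]; omega)]
  refine Finset.sum_congr rfl fun t ht => ?_
  rw [← Finset.sum_mul, ← Finset.mul_sum, ← qBinom_vandermonde,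
    show ((m + x : ℕ) : ℤ) + -(m : ℤ) = x by push_cast; ring]
  obtain ⟨k, rfl⟩ := Nat.exists_eq_add_of_le (show t ≤ x by rw [Finset.mem_range] at ht; omega)
  rw [Nat.add_sub_cancel_left, qBinom_symm]

/-- The binomials [x; t] and [y; t] have degrees t(x-t) and t(y-t), which the exponent in
`cCoeff_eq` compensates. -/
theorem cCoeff_mem (m x y : ℕ) : v ^ ((x : ℤ) * x + y * y - x * y) * cCoeff m x y ∈ Zv := by
  have hv := v_ne_zero
  rw [cCoeff_eq, Finset.mul_sum]
  refine sum_mem fun t ht => ?_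
  rw [Finset.mem_range] at ht
  rcases Nat.lt_or_ge y t with h | h
  · rw [qBinom_natCast_eq_zero h, mul_zero, mul_zero]
    exact zero_mem _
  obtain ⟨x, rfl⟩ := Nat.exists_eq_add_of_le (show t ≤ x by omega)
  obtain ⟨y, rfl⟩ := Nat.exists_eq_add_of_le h
  have hx := qBinom_natCast_mem_Zv (show t ≤ t + x by omega)
  have hy := qBinom_natCast_mem_Zv (show t ≤ t + y by omega)
  -- From here x and y stand for the old x - t and y - t. This quantity is the slack left after both
  -- binomial degrees are absorbed.
  have hp : 0 ≤ 2 * (x : ℤ) * y + m * x + m * y := by positivity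
  have := mul_mem (v_zpow_neg_mem_Zv hp) (mul_mem hx hy)
  convert this using 1
  have e : v ^ (((t + x : ℕ) : ℤ) * ((t + x : ℕ) : ℤ) + ((t + y : ℕ) : ℤ) * ((t + y : ℕ) : ℤ)
        - ((t + x : ℕ) : ℤ) * ((t + y : ℕ) : ℤ))
      * v ^ (-(((t + x : ℕ) : ℤ) * ((t + x : ℕ) : ℤ) + ((t + y : ℕ) : ℤ) * ((t + y : ℕ) : ℤ)
          + ((t + y : ℕ) : ℤ) * m + m * ((t + x : ℕ) : ℤ) + ((t + x : ℕ) : ℤ) * ((t + y : ℕ) : ℤ))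
        + t * (((t + x : ℕ) : ℤ) + ((t + y : ℕ) : ℤ) + 2 * m))
      = v ^ (-(2 * (x : ℤ) * y + m * x + m * y)) * (v ^ (-((t : ℤ) * (((t + x : ℕ) : ℤ) - t)))
        * v ^ (-((t : ℤ) * (((t + y : ℕ) : ℤ) - t)))) := by
    rw [← zpow_add₀ hv, ← zpow_add₀ hv, ← zpow_add₀ hv]
    congr 1
    push_cast
    ring
  linear_combination (qBinom ((t + x : ℕ) : ℤ) t * qBinom ((t + y : ℕ) : ℤ) t) * e

/-- Straightening both pairs of neighbouring powers brings E_{j+1}^{(c)} next to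
E_{j+1}^{(y+h_{j+1}+u)}; these merge, and the terms are collected by x = c + u. -/
theorem C_succ_eq (n : ℕ) (r h : ℕ → ℕ) (hr0 : r 0 = 0) (hrn : r n = 0) (j : ℕ) (hj : j + 1 ≤ n) :
    C n r h (j + 1) = ∑ x ∈ Finset.range (r (j + 1) + 1), ∑ y ∈ Finset.range (r j + 1),
      cCoeff (h (j + 1)) x y • (dpow (E n (j + 1 + 1)) x
        * (dpow (rootVec n (j + 1) (j + 1 + 1)) (r (j + 1) - x)
            * dpow (E n (j + 1)) (h (j + 1) + x + y))
        * (dpow (rootVec n j (j + 1)) (r j - y) * dpow (E n j) y)) := by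
  set m := h (j + 1) with hm
  set e1 := E n (j + 1) with he1
  set e2 := E n (j + 1 + 1) with he2
  set e0 := E n j with he0
  set z1 := rootVec n (j + 1) (j + 1 + 1) with hz1
  set z0 := rootVec n j (j + 1) with hz0
  set s := r (j + 1) with hs
  have hterm : ∀ u ∈ Finset.range (s + 1), qBinom (-(m : ℤ)) u •
      (dpow e1 (s - u) * dpow e2 s * dpow e0 (r j) * dpow e1 (m + r j + u))
      = ∑ c ∈ Finset.range (s + 1 - u), ∑ y ∈ Finset.range (r j + 1),
        (qBinom (-(m : ℤ)) u * (v⁻¹ ^ (c * (c + u)) * v⁻¹ ^ (y * (y + (m + u)))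
            * qBinom ((m + (c + u) + y : ℕ) : ℤ) c)) •
          (dpow e2 (c + u) * (dpow z1 (s - (c + u)) * dpow e1 (m + (c + u) + y))
            * (dpow z0 (r j - y) * dpow e0 y)) := by
    intro u hu
    rw [Finset.mem_range] at hu
    have h1 := dpow_E_mul_dpow_E_succ n (j + 1) (s - u) u (by
      intro h; rcases Nat.lt_or_ge (j + 1) n with h' | h'
      · omega
      · rw [hs, show j + 1 = n by omega, hrn] at h; omega)
    have h2 := dpow_E_mul_dpow_E_succ n j (r j) (m + u) (by
      intro h; rcases Nat.eq_zero_or_pos j with h' | h'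
      · rw [h', hr0] at h; omega
      · omega)
    rw [Nat.sub_add_cancel (by omega)] at h1
    rw [mul_assoc _ (dpow e0 (r j)), show m + r j + u = r j + (m + u) by ring, h1, h2,
      Finset.sum_mul_sum, Finset.smul_sum, show s + 1 - u = s - u + 1 by omega]
    refine Finset.sum_congr rfl fun c hc => ?_
    rw [Finset.smul_sum]
    refine Finset.sum_congr rfl fun y hy => ?_
    rw [smul_mul_smul_comm, smul_smul]
    have h3 : dpow e2 (c + u) * dpow z1 (s - u - c) * dpow e1 c
        * (dpow e1 (y + (m + u)) * dpow z0 (r j - y) * dpow e0 y)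
        = qBinom ((m + (c + u) + y : ℕ) : ℤ) c • (dpow e2 (c + u) * (dpow z1 (s - (c + u))
          * dpow e1 (m + (c + u) + y)) * (dpow z0 (r j - y) * dpow e0 y)) := by
      have h4 := dpow_mul_dpow e1 c (y + (m + u))
      rw [show c + (y + (m + u)) = m + (c + u) + y by ring] at h4
      rw [show s - u - c = s - (c + u) by omega, mul_assoc (dpow e1 (y + (m + u))), ← mul_assoc,
        mul_assoc _ (dpow e1 c), h4, mul_smul_comm, smul_mul_assoc, mul_assoc (dpow e2 (c + u))]
    rw [h3, smul_smul, mul_assoc]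
  rw [C, Nat.add_sub_cancel, Finset.sum_congr rfl hterm, ← Finset.sum_range_diag_flip (s + 1)
    (fun u c => ∑ y ∈ Finset.range (r j + 1),
        (qBinom (-(m : ℤ)) u * (v⁻¹ ^ (c * (c + u)) * v⁻¹ ^ (y * (y + (m + u)))
            * qBinom ((m + (c + u) + y : ℕ) : ℤ) c)) •
          (dpow e2 (c + u) * (dpow z1 (s - (c + u)) * dpow e1 (m + (c + u) + y))
            * (dpow z0 (r j - y) * dpow e0 y)))]
  refine Finset.sum_congr rfl fun x _ => ?_
  rw [Finset.sum_comm]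
  refine Finset.sum_congr rfl fun y _ => ?_
  rw [cCoeff, Finset.sum_smul]
  refine Finset.sum_congr rfl fun u hu => ?_
  rw [Finset.mem_range] at hu
  rw [Nat.sub_add_cancel (by omega)]

/-! ### Descending products -/

theorem descProd_of_le {R : Type} [Monoid R] {a b : ℕ} (h : b ≤ a) (f : ℕ → R) :
    descProd a b f = 1 := by
  simp [descProd, List.Ico.eq_nil_of_le h]

theorem descProd_succ_left {R : Type} [Monoid R] {a b : ℕ} (h : a < b) (f : ℕ → R) :
    descProd a b f = descProd (a + 1) b f * f a := by
  simp [descProd, List.Ico.eq_cons h]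

theorem descProd_congr {R : Type} [Monoid R] {a b : ℕ} {f g : ℕ → R}
    (h : ∀ i, a ≤ i → i < b → f i = g i) : descProd a b f = descProd a b g := by
  unfold descProd
  congr 1
  refine List.map_congr_left fun i hi => ?_
  rw [List.mem_reverse, List.Ico.mem] at hi
  exact h i hi.1 hi.2

theorem descProd_eq_one {R : Type} [Monoid R] {a b : ℕ} {f : ℕ → R}
    (h : ∀ i, a ≤ i → i < b → f i = 1) : descProd a b f = 1 := by
  refine List.prod_eq_one fun x hx => ?_
  obtain ⟨i, hi, rfl⟩ := List.mem_map.mp hx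
  rw [List.mem_reverse, List.Ico.mem] at hi
  exact h i hi.1 hi.2

theorem pbw_Mrh (n : ℕ) (r h : ℕ → ℕ) (hrn : r n = 0) : pbw n (Mrh n r h) = Erh n r h := by
  refine descProd_congr fun i hi1 hi2 => ?_
  rw [descProd_succ_left hi2, rootVec_self]
  have h1 : (Mrh n r h).mult i i = h i := by
    rw [RepClass.mult, dif_pos (by omega)]
    simp [Mrh]
  rw [h1]
  congr 1
  rcases Nat.lt_or_ge i n with hin | hin
  · have h2 : (Mrh n r h).mult i (i + 1) = r i := by
      rw [RepClass.mult, dif_pos (by omega)]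
      simp [Mrh]
    rw [descProd_succ_left (by omega), h2, descProd_eq_one, one_mul]
    intro j hj1 hj2
    have h3 : (Mrh n r h).mult i j = 0 := by
      rw [RepClass.mult, dif_pos (by omega)]
      simp only [Mrh]
      rw [if_neg (by omega), if_neg (by omega)]
    rw [h3, dpow_zero]
  · rw [descProd_of_le (by omega), show i = n by omega, hrn, dpow_zero]

/-! ### The lattices spanned by the rescaled PBW elements -/

/-- The factor `E_{i,i+1}^{(r_i-x_i)} E_i^{(h_i+x_i+x_{i-1})}`. -/
def pbwFactor (n : ℕ) (r h x : ℕ → ℕ) (i : ℕ) : U n :=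
  dpow (rootVec n i (i + 1)) (r i - x i) * dpow (E n i) (h i + x i + x (i - 1))

/-- The product of the factors `pbwFactor n r h x i` for `n ≥ i ≥ a`. -/
def pbwTail (n : ℕ) (r h : ℕ → ℕ) (a : ℕ) (x : ℕ → ℕ) : U n :=
  descProd a (n + 1) (pbwFactor n r h x)

/-- The quadratic form `∑_{p<n} (x_p² - x_p x_{p+1})`. -/
def quadForm (n : ℕ) (x : ℕ → ℕ) : ℤ :=
  ∑ p ∈ Finset.range n, ((x p : ℤ) * x p - x p * x (p + 1))

/-- The tuples `x` with `x_p ≤ r_p` that vanish outside `a ≤ p < n`. -/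
structure Admissible (n : ℕ) (r : ℕ → ℕ) (a : ℕ) (x : ℕ → ℕ) : Prop where
  le : ∀ p, x p ≤ r p
  lower : ∀ p, p < a → x p = 0
  upper : ∀ p, n ≤ p → x p = 0

/-- The rescaled product `v^{-q(x)} pbwTail n r h a x`, where `q` is `quadForm n`. -/
def scaledTail (n : ℕ) (r h : ℕ → ℕ) (a : ℕ) (x : ℕ → ℕ) : U n :=
  v ^ (-quadForm n x) • pbwTail n r h a x

/-- The `ℤ[v⁻¹]`-span of the rescaled products for `x ≠ 0`. -/
def tailLattice (n : ℕ) (r h : ℕ → ℕ) (a : ℕ) : Submodule Zv (U n) :=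
  Submodule.span Zv (scaledTail n r h a '' {x | Admissible n r a x ∧ x ≠ 0})

theorem Admissible.zero (n : ℕ) (r : ℕ → ℕ) (a : ℕ) : Admissible n r a 0 :=
  ⟨fun _ => Nat.zero_le _, fun _ _ => rfl, fun _ _ => rfl⟩

theorem Admissible.update {n : ℕ} {r : ℕ → ℕ} {a : ℕ} {x : ℕ → ℕ} (hx : Admissible n r (a + 1) x)
    {c : ℕ} (hc : c ≤ r a) (han : a < n ∨ c = 0) : Admissible n r a (Function.update x a c) where
  le p := by
    by_cases hp : p = a
    · subst hp; simpa using hc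
    · simpa [hp] using hx.le p
  lower p hp := by
    rw [Function.update_of_ne (by omega)]
    exact hx.lower p (by omega)
  upper p hp := by
    by_cases hpa : p = a
    · subst hpa; simp; omega
    · simpa [hpa] using hx.upper p hp

theorem pbwTail_zero_eq_scaledTail (n : ℕ) (r h : ℕ → ℕ) (a : ℕ) :
    scaledTail n r h a 0 = pbwTail n r h a 0 := by
  simp [scaledTail, quadForm]

/-- Only the summand at p = a changes: the one at a - 1 is zero before and after, since x_{a-1} = 0.
-/
theorem quadForm_update {n a c : ℕ} {x : ℕ → ℕ} (hx : ∀ p, p < a + 1 → x p = 0)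
    (han : a < n ∨ c = 0) :
    quadForm n (Function.update x a c) = quadForm n x + ((c : ℤ) * c - c * x (a + 1)) := by
  rcases han with han | rfl
  · rw [← sub_eq_iff_eq_add', quadForm, quadForm, ← Finset.sum_sub_distrib,
      Finset.sum_eq_single a]
    · simp [hx a (by omega)]
    · intro p _ hp
      rw [Function.update_of_ne hp]
      by_cases hpa : p + 1 = a
      · simp [hx p (by omega)]
      · rw [Function.update_of_ne hpa, sub_self]
    · intro h
      exact absurd (Finset.mem_range.mpr han) h
  · rw [← hx a (by omega), Function.update_eq_self, hx a (by omega)]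
    simp

theorem two_mul_quadForm (n : ℕ) (x : ℕ → ℕ) :
    2 * quadForm n x = ∑ p ∈ Finset.range n, ((x p : ℤ) - x (p + 1)) ^ 2 + (x 0 : ℤ) ^ 2
      - (x n : ℤ) ^ 2 := by
  induction n with
  | zero => simp [quadForm]
  | succ n ih =>
    rw [quadForm, Finset.sum_range_succ, ← quadForm, mul_add, ih, Finset.sum_range_succ]
    ring

/-- By `two_mul_quadForm`, twice the form is a sum of squares of successive differences. If it is
not positive, then x is constant, hence equal to x_0 = 0. -/
theorem quadForm_pos {n : ℕ} {x : ℕ → ℕ} (h0 : x 0 = 0) (hn : ∀ p, n ≤ p → x p = 0) (hx : x ≠ 0) :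
    0 < quadForm n x := by
  by_contra hq
  have h2 := two_mul_quadForm n x
  rw [h0, hn n le_rfl] at h2
  have hs : ∑ p ∈ Finset.range n, ((x p : ℤ) - x (p + 1)) ^ 2 = 0 :=
    le_antisymm (by simp at h2; omega) (Finset.sum_nonneg fun p _ => sq_nonneg _)
  rw [Finset.sum_eq_zero_iff_of_nonneg fun p _ => sq_nonneg _] at hs
  refine hx (funext fun p => ?_)
  induction p with
  | zero => exact h0
  | succ p ih =>
    rcases Nat.lt_or_ge p n with hp | hp
    · have := hs p (Finset.mem_range.mpr hp)
      rw [sq_eq_zero_iff, ih] at this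
      simp only [Pi.zero_apply] at this ⊢
      omega
    · exact hn _ (by omega)

theorem pbwTail_congr {n : ℕ} {r h : ℕ → ℕ} {a : ℕ} {x y : ℕ → ℕ}
    (hxy : ∀ p, a ≤ p + 1 → x p = y p) : pbwTail n r h a x = pbwTail n r h a y :=
  descProd_congr fun i hi _ => by
    rw [pbwFactor, pbwFactor, hxy i (by omega), hxy (i - 1) (by omega)]

theorem pbwTail_eq {n a : ℕ} (r h x : ℕ → ℕ) (ha : a ≤ n) :
    pbwTail n r h a x = pbwTail n r h (a + 1) x * pbwFactor n r h x a :=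
  descProd_succ_left (by omega) _

/-- If h_{a+1} = 0, the tail ends in E_{a+1}^{(x_{a+1})}, and merging with E_{a+1}^{(c)} gives a
binomial with leading exponent c·x_{a+1}. The alternative c = 0 serves the vertex n. -/
theorem pbwTail_mul_dpow {n a c : ℕ} {r h x : ℕ → ℕ} (hx : x a = 0)
    (han : a < n ∧ h (a + 1) = 0 ∨ c = 0) :
    ∃ z ∈ Zv, (c = 0 → z = 1) ∧ pbwTail n r h (a + 1) x * dpow (E n (a + 1)) c
      = (v ^ ((c : ℤ) * x (a + 1)) * z) • pbwTail n r h (a + 1) (Function.update x a c) := by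
  rcases Nat.eq_zero_or_pos c with rfl | hc
  · refine ⟨1, one_mem _, fun _ => rfl, ?_⟩
    rw [← hx, Function.update_eq_self, hx]
    simp [dpow_zero]
  · obtain ⟨han, hh⟩ : a < n ∧ h (a + 1) = 0 := by omega
    refine ⟨_, qBinom_natCast_mem_Zv (show x (a + 1) ≤ x (a + 1) + c by omega), by omega, ?_⟩
    rw [pbwTail_eq r h x (show a + 1 ≤ n from han),
      pbwTail_eq r h _ (show a + 1 ≤ n from han), pbwFactor, pbwFactor, mul_assoc, mul_assoc,
      Nat.add_sub_cancel, hx, hh, Nat.zero_add, Nat.add_zero, dpow_mul_dpow, ← mul_assoc (v ^ _),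
      ← zpow_add₀ v_ne_zero]
    rw [show pbwTail n r h (a + 1 + 1) (Function.update x a c) = pbwTail n r h (a + 1 + 1) x from
      pbwTail_congr fun p hp => Function.update_of_ne (by omega) _ _]
    simp [mul_comm (c : ℤ)]

/-- The condition that `X` has leading term `pbwTail n r h a 0`. -/
def HasLeadingTail (n : ℕ) (r h : ℕ → ℕ) (a : ℕ) (X : U n) : Prop :=
  X - pbwTail n r h a 0 ∈ tailLattice n r h a

/-- Reduces the passage from X to X·D to one computation on rescaled products. Only the index c₀ at
x = 0 may produce the zero tuple, and there it supplies the new leading term. -/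
theorem HasLeadingTail.mul {n : ℕ} {r h : ℕ → ℕ} {a b : ℕ} {X D : U n}
    (hX : HasLeadingTail n r h b X) {ι : Type} (S : Finset ι) (c₀ : ι) (hc₀ : c₀ ∈ S)
    (hD : ∀ x, Admissible n r b x → ∃ (z : ι → K) (f : ι → ℕ → ℕ),
      (∀ c ∈ S, z c ∈ Zv ∧ Admissible n r a (f c) ∧ ((x ≠ 0 ∨ c ≠ c₀) → f c ≠ 0)) ∧
      (x = 0 → z c₀ = 1 ∧ f c₀ = 0) ∧
      scaledTail n r h b x * D = ∑ c ∈ S, z c • scaledTail n r h a (f c)) :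
    HasLeadingTail n r h a (X * D) := by
  classical
  have hmem : ∀ {z : K} {f : ℕ → ℕ}, z ∈ Zv → Admissible n r a f → f ≠ 0 →
      z • scaledTail n r h a f ∈ tailLattice n r h a := fun {z f} hz hf hf0 =>
    (tailLattice n r h a).smul_mem ⟨z, hz⟩ (Submodule.subset_span ⟨f, ⟨hf, hf0⟩, rfl⟩)
  have h1 : pbwTail n r h b 0 * D - pbwTail n r h a 0 ∈ tailLattice n r h a := by
    obtain ⟨z, f, hzf, h0, hsum⟩ := hD 0 (Admissible.zero n r b)
    obtain ⟨hz0, hf0⟩ := h0 rfl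
    rw [← pbwTail_zero_eq_scaledTail, hsum, ← Finset.add_sum_erase S _ hc₀, hz0, hf0, one_smul,
      pbwTail_zero_eq_scaledTail, add_sub_cancel_left]
    refine sum_mem fun c hc => ?_
    obtain ⟨hcne, hcS⟩ := Finset.mem_erase.mp hc
    obtain ⟨hz, hf, hne⟩ := hzf c hcS
    exact hmem hz hf (hne (Or.inr hcne))
  have h2 : ∀ Y ∈ tailLattice n r h b, Y * D ∈ tailLattice n r h a := by
    intro Y hY
    induction hY using Submodule.span_induction with
    | mem Y hY =>
      obtain ⟨x, ⟨hx, hx0⟩, rfl⟩ := hY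
      obtain ⟨z, f, hzf, -, hsum⟩ := hD x hx
      rw [hsum]
      refine sum_mem fun c hc => ?_
      obtain ⟨hz, hf, hne⟩ := hzf c hc
      exact hmem hz hf (hne (Or.inl hx0))
    | zero => rw [zero_mul]; exact zero_mem _
    | add Y Z _ _ ihY ihZ => rw [add_mul]; exact add_mem ihY ihZ
    | smul z Y _ ih =>
      have : z • Y * D = z • (Y * D) := smul_mul_assoc (z : K) Y D
      rw [this]
      exact Submodule.smul_mem _ z ih
  have h3 := add_mem (h2 _ hX) h1
  rwa [sub_mul, sub_add_sub_cancel] at h3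

theorem update_ne_zero {x : ℕ → ℕ} {a c : ℕ} (hx : x a = 0) (h : x ≠ 0 ∨ c ≠ 0) :
    Function.update x a c ≠ 0 := by
  intro h0
  have hc : c = 0 := by simpa using congrFun h0 a
  rcases h with h | h
  · rw [hc, ← hx, Function.update_eq_self] at h0
    exact h h0
  · exact h hc

/-- The exponent -c² from straightening and c·x_{a+1} from merging add up to the change of -q, so
only the integral part of the binomial remains. -/
theorem HasLeadingTail.mul_dpow_mul_dpow {n a : ℕ} {r h : ℕ → ℕ} (hr0 : r 0 = 0) (ha : a < n)
    (hh : h a = 0) (hh' : h (a + 1) = 0) {X : U n} (hX : HasLeadingTail n r h (a + 1) X) :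
    HasLeadingTail n r h a (X * (dpow (E n a) (r a) * dpow (E n (a + 1)) (r a))) := by
  refine hX.mul (Finset.range (r a + 1)) 0 (by simp) fun x hx => ?_
  have hxa : x a = 0 := hx.lower a (by omega)
  choose z hz hz0 hzT using fun c => pbwTail_mul_dpow (n := n) (c := c) (r := r) (h := h) hxa
    (Or.inl ⟨ha, hh'⟩)
  refine ⟨z, fun c => Function.update x a c, fun c hc => ⟨hz c, ?_, ?_⟩, fun hx0 => ⟨hz0 0 rfl, ?_⟩, ?_⟩
  · rw [Finset.mem_range] at hc
    exact hx.update (by omega) (Or.inl ha)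
  · exact update_ne_zero hxa
  · simp only
    rw [← hxa, Function.update_eq_self, hx0]
  · have h1 := dpow_E_mul_dpow_E_succ n a (r a) 0 (by
      intro hra
      rcases Nat.eq_zero_or_pos a with h' | h'
      · rw [h'] at hra; exact absurd hr0 hra
      · omega)
    rw [Nat.add_zero (r a)] at h1
    rw [h1, Finset.mul_sum]
    refine Finset.sum_congr rfl fun c hc => ?_
    rw [Finset.mem_range] at hc
    have h2 : pbwTail n r h a (Function.update x a c)
        = pbwTail n r h (a + 1) (Function.update x a c)
          * (dpow (rootVec n a (a + 1)) (r a - c) * dpow (E n a) c) := by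
      rw [pbwTail_eq r h _ ha.le, pbwFactor, Function.update_self, hh, Nat.zero_add]
      rcases Nat.eq_zero_or_pos a with h' | h'
      -- At vertex 0 truncated subtraction gives a - 1 = a, but r_0 = 0 forces c = 0.
      · subst h'
        rw [show c = 0 by omega]
        simp
      · rw [Function.update_of_ne (show a - 1 ≠ a by omega), hx.lower (a - 1) (by omega),
          Nat.add_zero c]
    simp only
    rw [scaledTail, scaledTail, h2, Nat.add_zero c, mul_smul_comm, smul_mul_assoc,
      mul_assoc (dpow (E n (a + 1)) c), ← mul_assoc (pbwTail n r h (a + 1) x), hzT c,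
      smul_mul_assoc, smul_smul, smul_smul, smul_smul, quadForm_update hx.lower (Or.inl ha)]
    congr 1
    rw [inv_pow, ← zpow_natCast, ← zpow_neg, mul_comm (z c), ← mul_assoc,
      ← zpow_add₀ v_ne_zero, ← zpow_add₀ v_ne_zero]
    congr 2
    push_cast
    ring

/-- The entries x_{j+1} = c and x_j = d are created together and raise q by c² + d² - cd -
c·x_{j+2}. The first three terms are absorbed by `cCoeff_mem`, the last by the merge at vertex j +
2. -/
theorem HasLeadingTail.mul_C {n j : ℕ} {r h : ℕ → ℕ} (hr0 : r 0 = 0) (hrn : r n = 0)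
    (hj : j + 1 ≤ n) (hh : h j = 0) (hh' : j + 1 < n → h (j + 1 + 1) = 0) {X : U n}
    (hX : HasLeadingTail n r h (j + 1 + 1) X) :
    HasLeadingTail n r h j (X * C n r h (j + 1)) := by
  have hv := v_ne_zero
  refine hX.mul (Finset.range (r (j + 1) + 1) ×ˢ Finset.range (r j + 1)) (0, 0) (by simp)
    fun x hx => ?_
  have hx1 : x (j + 1) = 0 := hx.lower _ (by omega)
  have hx0 : x j = 0 := hx.lower _ (by omega)
  have hcond : ∀ c, c ≤ r (j + 1) → j + 1 < n ∨ c = 0 := by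
    intro c hc
    rcases Nat.lt_or_ge (j + 1) n with h' | h'
    · exact Or.inl h'
    · rw [show j + 1 = n by omega, hrn] at hc
      omega
  -- The identity is available only for c ≤ r_{j+1}; the value 1 elsewhere is a filler that makes z
  -- a total function.
  have hex : ∀ c, ∃ z ∈ Zv, (c = 0 → z = 1) ∧ (c ≤ r (j + 1) →
      pbwTail n r h (j + 1 + 1) x * dpow (E n (j + 1 + 1)) c
      = (v ^ ((c : ℤ) * x (j + 1 + 1)) * z)
        • pbwTail n r h (j + 1 + 1) (Function.update x (j + 1) c)) := by
    intro c
    by_cases hc : c ≤ r (j + 1)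
    · obtain ⟨z, hz, hz0, hzT⟩ := pbwTail_mul_dpow (n := n) (c := c) (r := r) (h := h) hx1
        ((hcond c hc).imp_left fun h' => ⟨h', hh' h'⟩)
      exact ⟨z, hz, hz0, fun _ => hzT⟩
    · exact ⟨1, one_mem _, fun _ => rfl, fun h' => absurd h' hc⟩
  choose z hz hz0 hzT using hex
  have hu0 : ∀ c, Function.update x (j + 1) c j = 0 := fun c => by
    rw [Function.update_of_ne (by omega), hx0]
  refine ⟨fun c => (v ^ ((c.1 : ℤ) * c.1 + c.2 * c.2 - c.1 * c.2) * cCoeff (h (j + 1)) c.1 c.2)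
      * z c.1, fun c => Function.update (Function.update x (j + 1) c.1) j c.2, ?_, ?_, ?_⟩
  · rintro ⟨c, d⟩ hcd
    simp only [Finset.mem_product, Finset.mem_range] at hcd
    refine ⟨mul_mem (cCoeff_mem _ _ _) (hz c),
      (hx.update (by omega) (hcond c (by omega))).update (by omega) (Or.inl (by omega)), ?_⟩
    intro hne
    refine update_ne_zero (hu0 c) ?_
    by_cases hd : d = 0
    · refine Or.inl (update_ne_zero hx1 (hne.imp_right fun h' hc => h' ?_))
      rw [show c = 0 from hc, hd]
    · exact Or.inr hd
  · rintro rfl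
    simp [cCoeff_zero_zero, hz0 0 rfl]
  · rw [C_succ_eq n r h hr0 hrn j hj, Finset.mul_sum, Finset.sum_product]
    refine Finset.sum_congr rfl fun c hc => ?_
    rw [Finset.mul_sum]
    refine Finset.sum_congr rfl fun d hd => ?_
    rw [Finset.mem_range] at hc hd
    set y := Function.update (Function.update x (j + 1) c) j d with hy
    have hy1 : y (j + 1) = c := by
      rw [hy, Function.update_of_ne (by omega), Function.update_self]
    have hy0 : y j = d := by rw [hy, Function.update_self]
    have hyj : y j + y (j - 1) = d := by
      rcases Nat.eq_zero_or_pos j with h' | h'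
      · subst h'
        rw [hy0]
        omega
      · rw [hy0, hy, Function.update_of_ne (by omega), Function.update_of_ne (by omega),
          hx.lower _ (by omega), Nat.add_zero]
    have h2 : pbwTail n r h j y = pbwTail n r h (j + 1 + 1) (Function.update x (j + 1) c)
        * (dpow (rootVec n (j + 1) (j + 1 + 1)) (r (j + 1) - c)
            * dpow (E n (j + 1)) (h (j + 1) + c + d))
        * (dpow (rootVec n j (j + 1)) (r j - d) * dpow (E n j) d) := by
      rw [pbwTail_eq r h _ (by omega), pbwTail_eq r h _ hj, pbwFactor, pbwFactor, hy1,
        Nat.add_sub_cancel, hy0, hh, Nat.zero_add, ← hy0, hyj, hy0,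
        pbwTail_congr (y := Function.update x (j + 1) c)
          fun p hp => Function.update_of_ne (by omega) _ _]
    have hq : quadForm n y = quadForm n x + ((c : ℤ) * c - c * x (j + 1 + 1))
        + ((d : ℤ) * d - d * c) := by
      rw [hy, quadForm_update _ (Or.inl (by omega)), quadForm_update hx.lower (hcond c (by omega)),
        Function.update_self]
      intro p hp
      rw [Function.update_of_ne (by omega)]
      exact hx.lower p (by omega)
    rw [scaledTail, scaledTail, h2, hq, smul_mul_assoc, mul_smul_comm,
      ← mul_assoc (pbwTail n r h (j + 1 + 1) x) (dpow _ c * _),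
      ← mul_assoc (pbwTail n r h (j + 1 + 1) x) (dpow _ c), hzT c (by omega),
      smul_mul_assoc, smul_mul_assoc, smul_smul, smul_smul, smul_smul]
    congr 1
    have e : v ^ (-quadForm n x) * v ^ ((c : ℤ) * x (j + 1 + 1))
        = v ^ ((c : ℤ) * c + d * d - c * d)
          * v ^ (-(quadForm n x + ((c : ℤ) * c - c * x (j + 1 + 1)) + ((d : ℤ) * d - d * c))) := by
      rw [← zpow_add₀ hv, ← zpow_add₀ hv]
      congr 1
      ring
    linear_combination (cCoeff (h (j + 1)) c d * z c) * e

/-! ### Assembling the factors along Ω -/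

theorem HasLeadingTail.mul_B {n b : ℕ} {r h : ℕ → ℕ} (hr0 : r 0 = 0) (hbn : b ≤ n) (a : ℕ)
    (hab : a ≤ b) (hh : ∀ p, a ≤ p → p ≤ b → h p = 0) {X : U n} (hX : HasLeadingTail n r h b X) :
    HasLeadingTail n r h a (X * B n r a b) := by
  induction hab using Nat.decreasingInduction with
  | self => rwa [B, descProd_of_le le_rfl, mul_one]
  | of_succ a hab ih =>
    rw [B, descProd_succ_left hab, ← mul_assoc]
    exact (ih fun p hp hpb => hh p (by omega) hpb).mul_dpow_mul_dpow hr0 (by omega)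
      (hh a le_rfl hab.le) (hh (a + 1) (by omega) hab)

theorem HasLeadingTail.one (n : ℕ) (r h : ℕ → ℕ) : HasLeadingTail n r h (n + 1) 1 := by
  rw [HasLeadingTail, pbwTail, descProd_of_le le_rfl, sub_self]
  exact zero_mem _

theorem HasLeadingTail.one_of_eq_zero {n : ℕ} {r h : ℕ → ℕ} (hrn : r n = 0) (hhn : h n = 0) :
    HasLeadingTail n r h n 1 := by
  rw [HasLeadingTail, pbwTail_eq r h _ le_rfl, pbwTail, descProd_of_le le_rfl, pbwFactor]
  simp [hrn, hhn, dpow_zero]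

/-- A vertex j + 1 of Ω accounts for the tail factors at j + 1 and j, and B supplies those from j -
1 down to a. By sparseness the rest of the list starts at j + 3 or later, which preserves the bound
a + 1 ≤ p. -/
theorem hasLeadingTail_EOmegaAux {n : ℕ} {r h : ℕ → ℕ} (hr0 : r 0 = 0) (hrn : r n = 0)
    (hsparse : ∀ p, p + 1 ≤ n → h p = 0 ∨ h (p + 1) = 0) (l : List ℕ) (a : ℕ) (han : a ≤ n + 1)
    (hsort : l.Pairwise (· < ·)) (hl : ∀ p ∈ l, a + 1 ≤ p ∧ p ≤ n)
    (hmem : ∀ p, a ≤ p → p ≤ n → (p ∈ l ↔ h p ≠ 0)) :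
    HasLeadingTail n r h a (EOmegaAux n r h a l) := by
  induction l generalizing a with
  | nil =>
    rw [EOmegaAux]
    rcases Nat.lt_or_ge n a with h' | h'
    · rw [B, descProd_of_le h'.le, show a = n + 1 by omega]
      exact HasLeadingTail.one n r h
    · have hh : ∀ p, a ≤ p → p ≤ n → h p = 0 := by simpa using hmem
      rw [← one_mul (B n r a n)]
      -- Here the leading factor at vertex n is trivial, so the tail can start at n, where B_{a,n}
      -- attaches.
      exact (HasLeadingTail.one_of_eq_zero hrn (hh n h' le_rfl)).mul_B hr0 le_rfl a h' hh
  | cons i l ih =>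
    rw [EOmegaAux]
    rw [List.pairwise_cons] at hsort
    obtain ⟨hai, hin⟩ := hl i List.mem_cons_self
    obtain ⟨j, rfl⟩ : ∃ j, i = j + 1 := ⟨i - 1, by omega⟩
    have hi : h (j + 1) ≠ 0 := (hmem (j + 1) (by omega) hin).mp List.mem_cons_self
    have hsucc : j + 1 < n → h (j + 1 + 1) = 0 := fun h' => (hsparse (j + 1) h').resolve_left hi
    have hX : HasLeadingTail n r h (j + 1 + 1) (EOmegaAux n r h (j + 1 + 1) l) := by
      refine ih (j + 1 + 1) (by omega) hsort.2 (fun p hp => ?_) fun p hp hpn => ?_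
      · have h1 := hsort.1 p hp
        have h2 := hl p (List.mem_cons_of_mem _ hp)
        have h3 := (hmem p (by omega) h2.2).mp (List.mem_cons_of_mem _ hp)
        refine ⟨?_, h2.2⟩
        by_contra h4
        rw [show p = j + 1 + 1 by omega] at h3 h2
        exact h3 (hsucc h2.2)
      · rw [← hmem p (by omega) hpn, List.mem_cons]
        exact ⟨Or.inr, fun h' => h'.resolve_left (by omega)⟩
    have hlow : ∀ p, a ≤ p → p ≤ j → h p = 0 := by
      intro p hap hpj
      by_contra h1
      rcases List.mem_cons.mp ((hmem p hap (by omega)).mpr h1) with h2 | h2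
      · omega
      · have := hsort.1 p h2
        omega
    rw [Nat.add_sub_cancel]
    exact (hX.mul_C hr0 hrn hin (hlow j (by omega) le_rfl) hsucc).mul_B hr0 (by omega) a (by omega)
      hlow

/-! ### Invariance under the bar involution -/

theorem bar_dpow_E (n i m : ℕ) :
    UPlus.bar (CartanMatrix.A n) (dpow (E n i) m) = dpow (E n i) m := by
  have hE : UPlus.bar (CartanMatrix.A n) (E n i) = E n i := by
    rw [E]
    split_ifs
    · exact UPlus.bar_gen _ _
    · exact map_one _
  rw [dpow, UPlus.bar_smul, map_pow, hE, map_inv₀, barK_qFactorial]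

theorem bar_B (n : ℕ) (r : ℕ → ℕ) (a b : ℕ) :
    UPlus.bar (CartanMatrix.A n) (B n r a b) = B n r a b := by
  rw [B, descProd, map_list_prod, List.map_map]
  congr 2
  funext p
  rw [Function.comp_apply, map_mul, bar_dpow_E, bar_dpow_E]

theorem bar_C (n : ℕ) (r h : ℕ → ℕ) (i : ℕ) :
    UPlus.bar (CartanMatrix.A n) (C n r h i) = C n r h i := by
  simp only [C, map_sum, UPlus.bar_smul, barK_qBinom, map_mul, bar_dpow_E]

theorem bar_EOmegaAux (n : ℕ) (r h : ℕ → ℕ) (a : ℕ) (l : List ℕ) :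
    UPlus.bar (CartanMatrix.A n) (EOmegaAux n r h a l) = EOmegaAux n r h a l := by
  induction l generalizing a with
  | nil => exact bar_B n r a n
  | cons i l ih => rw [EOmegaAux, map_mul, map_mul, ih, bar_B, bar_C]

/-! ### The expansion of `EOmega` -/

/-- A nonzero x strictly lowers the multiplicity of some U_{p,p+1} with 1 ≤ p < n. -/
theorem Mrh_sub_ne {n : ℕ} {r h x g : ℕ → ℕ} (hr0 : r 0 = 0) (hx : Admissible n r 0 x)
    (hx0 : x ≠ 0) : Mrh n (fun p => r p - x p) g ≠ Mrh n r h := by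
  obtain ⟨p, hp⟩ := Function.ne_iff.mp hx0
  rw [Pi.zero_apply] at hp
  have hle := hx.le p
  have hp1 : 1 ≤ p := by
    by_contra hp1
    rw [show p = 0 by omega, hr0] at hle
    rw [show p = 0 by omega] at hp
    omega
  have hpn : p < n := by
    by_contra hpn
    exact hp (hx.upper p (by omega))
  intro heq
  have := congrFun heq ⟨(p, p + 1), by simp; omega⟩
  simp [Mrh] at this
  omega

theorem pbwTail_zero_eq_pbw {n : ℕ} {r h x : ℕ → ℕ} (hr0 : r 0 = 0) (hrn : r n = 0) (hh0 : h 0 = 0)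
    (hx : Admissible n r 0 x) :
    pbwTail n r h 0 x = pbw n (Mrh n (fun p => r p - x p) (fun p => h p + x p + x (p - 1))) := by
  have hx0 : x 0 = 0 := Nat.le_zero.mp ((hx.le 0).trans_eq hr0)
  rw [pbw_Mrh n _ _ (by rw [hrn, Nat.zero_sub]), pbwTail_eq r h x (Nat.zero_le n), pbwFactor]
  simp only [hr0, hh0, hx0, Nat.sub_zero, Nat.add_zero, dpow_zero, mul_one]
  rfl

/-- Each generator is a single PBW element scaled by v^{-q(x)} with q(x) > 0, and the required
properties survive ℤ[v⁻¹]-combinations. -/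
theorem exists_expansion_of_mem_tailLattice {n : ℕ} {r h : ℕ → ℕ} (hr0 : r 0 = 0) (hrn : r n = 0)
    (hh0 : h 0 = 0) {X : U n} (hX : X ∈ tailLattice n r h 0) :
    ∃ ζ : RepClass n →₀ K, X = Finsupp.linearCombination K (pbw n) ζ ∧ ζ (Mrh n r h) = 0 ∧
      ∀ N, ∃ c ∈ Zv, ζ N = v⁻¹ * c := by
  classical
  induction hX using Submodule.span_induction with
  | mem X hX =>
    obtain ⟨x, ⟨hx, hx0⟩, rfl⟩ := hX
    have hq := quadForm_pos (Nat.le_zero.mp ((hx.le 0).trans_eq hr0)) hx.upper hx0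
    refine ⟨Finsupp.single (Mrh n (fun p => r p - x p) (fun p => h p + x p + x (p - 1)))
      (v ^ (-quadForm n x)), ?_, ?_, fun N => ?_⟩
    · rw [Finsupp.linearCombination_single, scaledTail, pbwTail_zero_eq_pbw hr0 hrn hh0 hx]
    · exact Finsupp.single_eq_of_ne (Mrh_sub_ne hr0 hx hx0).symm
    · rw [Finsupp.single_apply]
      split_ifs
      · refine ⟨v ^ (-(quadForm n x - 1)), v_zpow_neg_mem_Zv (by omega), ?_⟩
        rw [← zpow_neg_one, ← zpow_add₀ v_ne_zero]
        congr 1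
        ring
      · exact ⟨0, zero_mem _, (mul_zero _).symm⟩
  | zero => exact ⟨0, by simp, rfl, fun N => ⟨0, zero_mem _, by simp⟩⟩
  | add X Y _ _ hX hY =>
    obtain ⟨ζ, rfl, h0, hζ⟩ := hX
    obtain ⟨ξ, rfl, h0', hξ⟩ := hY
    refine ⟨ζ + ξ, (map_add _ _ _).symm, by rw [Finsupp.add_apply, h0, h0', add_zero], fun N => ?_⟩
    obtain ⟨c, hc, hcN⟩ := hζ N
    obtain ⟨d, hd, hdN⟩ := hξ N
    exact ⟨c + d, add_mem hc hd, by rw [Finsupp.add_apply, hcN, hdN, mul_add]⟩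
  | smul z X _ hX =>
    obtain ⟨ζ, rfl, h0, hζ⟩ := hX
    refine ⟨(z : K) • ζ, (map_smul (Finsupp.linearCombination K (pbw n)) (z : K) ζ).symm,
      by rw [Finsupp.smul_apply, h0, smul_zero],
      fun N => ?_⟩
    obtain ⟨c, hc, hcN⟩ := hζ N
    exact ⟨z * c, mul_mem z.2 hc, by rw [Finsupp.smul_apply, hcN, smul_eq_mul, mul_left_comm]⟩

theorem HasLeadingTail.exists_expansion {n : ℕ} {r h : ℕ → ℕ} (hr0 : r 0 = 0) (hrn : r n = 0)
    (hh0 : h 0 = 0) {X : U n} (hX : HasLeadingTail n r h 0 X) :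
    ∃ ζ : RepClass n →₀ K, (X = ζ.sum fun N c => c • pbw n N) ∧ ζ (Mrh n r h) = 1 ∧
      ∀ N, N ≠ Mrh n r h → ∃ c ∈ Zv, ζ N = v⁻¹ * c := by
  classical
  obtain ⟨ζ, hζX, hζ0, hζ⟩ := exists_expansion_of_mem_tailLattice hr0 hrn hh0 hX
  refine ⟨Finsupp.single (Mrh n r h) 1 + ζ, ?_, ?_, fun N hN => ?_⟩
  · rw [← Finsupp.linearCombination_apply, map_add, ← hζX, Finsupp.linearCombination_single,
      one_smul, pbwTail_zero_eq_pbw hr0 hrn hh0 (Admissible.zero n r 0)]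
    exact (add_sub_cancel _ _).symm
  · rw [Finsupp.add_apply, hζ0, Finsupp.single_eq_same, add_zero]
  · rw [Finsupp.add_apply, Finsupp.single_eq_of_ne hN, zero_add]
    exact hζ N

/-! ### Vertex 0 and the conclusion -/

theorem B_zero_left (n : ℕ) (r : ℕ → ℕ) (hr0 : r 0 = 0) (b : ℕ) : B n r 0 b = B n r 1 b := by
  rcases Nat.eq_zero_or_pos b with rfl | hb
  · rw [B, B, descProd_of_le le_rfl, descProd_of_le (Nat.zero_le 1)]
  · rw [B, descProd_succ_left hb, hr0, dpow_zero, dpow_zero, one_mul, mul_one, B]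

/-- Starting at 0 lets i_1 = 1 be treated like any other vertex of Ω: C_1 already extends the tail
to vertex 0. -/
theorem EOmegaAux_zero_left (n : ℕ) (r h : ℕ → ℕ) (hr0 : r 0 = 0) (l : List ℕ) :
    EOmegaAux n r h 0 l = EOmegaAux n r h 1 l := by
  cases l with
  | nil => exact B_zero_left n r hr0 n
  | cons i l => rw [EOmegaAux, EOmegaAux, B_zero_left n r hr0]

theorem EOmegaAux_congr {n : ℕ} {r h g : ℕ → ℕ} (l : List ℕ) (a : ℕ) (hl : ∀ i ∈ l, h i = g i) :
    EOmegaAux n r h a l = EOmegaAux n r g a l := by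
  induction l generalizing a with
  | nil => rfl
  | cons i l ih =>
    rw [EOmegaAux, EOmegaAux, ih _ fun p hp => hl p (List.mem_cons_of_mem _ hp), C, C,
      hl i List.mem_cons_self]

theorem hasLeadingTail_EOmega {n : ℕ} {r h : ℕ → ℕ} (hr0 : r 0 = 0) (hrn : r n = 0)
    (hh0 : h 0 = 0) (hsparse : IsSparse n (Omega n h)) :
    HasLeadingTail n r h 0 (EOmega n r h) := by
  rw [EOmega, ← EOmegaAux_zero_left n r h hr0]
  refine hasLeadingTail_EOmegaAux hr0 hrn ?_ _ 0 (Nat.zero_le _)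
    (Finset.sortedLT_sort _).pairwise ?_ ?_
  · intro p hp
    rcases Nat.eq_zero_or_pos p with rfl | hp0
    · exact Or.inl hh0
    · refine (hsparse p hp0 hp).imp (fun h1 => ?_) fun h1 => ?_ <;>
      · by_contra h2
        exact h1 (Finset.mem_filter.mpr ⟨Finset.mem_Icc.mpr (by omega), h2⟩)
  · intro p hp
    rw [Finset.mem_sort, Omega, Finset.mem_filter, Finset.mem_Icc] at hp
    omega
  · intro p _ hpn
    rw [Finset.mem_sort, Omega, Finset.mem_filter, Finset.mem_Icc]
    refine ⟨fun hp => hp.2, fun hp => ⟨⟨?_, hpn⟩, hp⟩⟩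
    by_contra hp1
    rw [show p = 0 by omega] at hp
    exact hp hh0

theorem isCanonicalAt_EOmega {n : ℕ} {r h : ℕ → ℕ} (hr0 : r 0 = 0) (hrn : r n = 0)
    (hsparse : IsSparse n (Omega n h)) : IsCanonicalAt n (Mrh n r h) (EOmega n r h) := by
  -- The value h 0 is arbitrary and irrelevant to the statement, but the tails starting at 0 need it
  -- to vanish; hence it is reset to 0.
  have hg : ∀ i, 1 ≤ i → Function.update h 0 0 i = h i := fun i hi =>
    Function.update_of_ne (by omega) _ _
  have hΩ : Omega n (Function.update h 0 0) = Omega n h :=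
    Finset.filter_congr fun i hi => by rw [hg i (Finset.mem_Icc.mp hi).1]
  have hM : Mrh n r (Function.update h 0 0) = Mrh n r h := by
    funext p
    rw [Mrh, Mrh, hg _ p.2.1]
  have hE : EOmega n r (Function.update h 0 0) = EOmega n r h := by
    rw [EOmega, EOmega, hΩ]
    refine EOmegaAux_congr _ _ fun i hi => hg i ?_
    rw [Finset.mem_sort, Omega, Finset.mem_filter, Finset.mem_Icc] at hi
    exact hi.1.1
  have h0 : Function.update h 0 0 0 = 0 := Function.update_self _ _ _
  rw [← hE, ← hM]
  exact ⟨bar_EOmegaAux n r _ 1 _,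
    (hasLeadingTail_EOmega hr0 hrn h0 (hΩ ▸ hsparse)).exists_expansion hr0 hrn h0⟩

end QGroup

end

theorem mainTheorem2 (n : ℕ) (r h : ℕ → ℕ) (hr0 : r 0 = 0) (hrn : r n = 0)
    (hsparse : QGroup.IsSparse n (QGroup.Omega n h)) :
    QGroup.EOmega n r h ∈ QGroup.canonicalBasis n ∧
    QGroup.IsCanonicalAt n (QGroup.Mrh n r h) (QGroup.EOmega n r h) ∧
    QGroup.pbw n (QGroup.Mrh n r h) = QGroup.Erh n r h := by
  have hcan := QGroup.isCanonicalAt_EOmega hr0 hrn hsparse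
  exact ⟨⟨_, hcan⟩, hcan, QGroup.pbw_Mrh n r h hrn⟩
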